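/- Let $m,n\ge 1$, $B_0=\{1,\overline1,\dots,m,\overline m\}$, $B_1=\{1^\circ,\dots,n^\circ\}$, with the order $1<\overline1<2<\overline2<\dots<m<\overline m<1^\circ<\dots<n^\circ$ on $B=B_0\cup B_1$. An $spo(2m,n)$-tableau of shape $\lambda$ is a filling of the Young diagram of the partition $\lambda$ (possibly empty) with entries from $B$ such that the boxes with entries in $B_0$ form a Young diagram on which rows increase weakly, columns increase strictly and every entry in row $i$ is at least the letter $i$, while the entries in $B_1$ increase strictly along rows and weakly down columns. A letter $x\in B$ is inserted into an $spo$-tableau as follows. Start in the first row if $x\in B_0$, and in the first column if $x\in B_1$. To insert a letter into a row (if it is in $B_0$) or a column (if it is in $B_1$), put it in a new box at the end if no entry there is larger; otherwise let it replace the first entry $y$ there that is larger, and insert $y$ into the next row (counted from the box that $y$ leaves) if $y\in B_0$, into the next column if $y\in B_1$. There is one exception: if for some $i$ the letter $i$ would replace $\overline i$ in row $i$, then instead $\overline i$ is removed, the letter $i$ is discarded, and the resulting empty box is moved by jeu de taquin: with $a$ the entry to its right and $b$ the entry below it, $a$ moves into the empty box if $a<b$ or $a=b\in B_1$, and $b$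 moves into it if $b<a$ or $a=b\in B_0$ (the only neighbour moves if there is just one), until there is no entry to the right or below; the empty box is then deleted. The result is denoted $T\leftarrow x$ for $x\in B_0$ and $x\to T$ for $x\in B_1$. For a one-row $spo$-tableau $U=(a_1,\dots,a_r,b_1,\dots,b_t)$ with $a_i\in B_0$, $b_i\in B_1$, put $$T\cdot U=(b_1\to\cdots\to b_t\to T)\leftarrow a_1\leftarrow\cdots\leftarrow a_r .$$ A horizontal strip is a skew diagram $\lambda/\mu$ (with $\mu\subseteq\lambda$) with no two boxes in the same column. A triple $(\lambda,\mu,\nu)$ with $\mu\subseteq\lambda$ and $\mu\subseteq\nu$ is an $sp$-bumping sequence if $\lambda/\mu$ and $\nu/\mu$ are horizontal strips. Corollary. Let $k\ge 0$, let $T$ be an $spo(2m,n)$-tableau of shape $\lambda$ and $U$ a one-row $spo(2m,n)$-tableau with $k$ boxes. Then $T\cdot U$ is an $spo(2m,n)$-tableau whose shape $\nu$ is the end shape of an $sp$-bumping sequence $(\lambda,\mu,\nu)$ such that, for some $0\le\ell\le k$, $|\lambda/\mu|=\ell$ and $|\nu/\mu|=k-\ell$. -/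

import Mathlib

namespace Spo

/-- The alphabet `B = B₀ ∪ B₁` of an `spo(2m,n)`-tableau. The letters are indexed from zero:
`plain i` is the letter `i + 1` and `bar i` its barred version, which together make up `B₀`,
and `circ j` is the letter `(j + 1)°` of `B₁`. -/
inductive Letter (m n : ℕ) : Type
  | plain (i : Fin m) : Letter m n
  | bar (i : Fin m) : Letter m n
  | circ (j : Fin n) : Letter m n

namespace Letter

/-- Position in the order `1 < 1̄ < 2 < 2̄ < ⋯ < m < m̄ < 1° < ⋯ < n°`. -/
def key {m n : ℕ} : Letter m n → ℕ
  | plain i => 2 * (i : ℕ)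
  | bar i => 2 * (i : ℕ) + 1
  | circ j => 2 * m + (j : ℕ)

theorem key_injective {m n : ℕ} : Function.Injective (key : Letter m n → ℕ) := by
  intro a b h
  cases a <;> cases b <;> simp only [key] at h <;> simp only [plain.injEq, bar.injEq, circ.injEq, Fin.ext_iff, reduceCtorEq] <;> omega

noncomputable instance {m n : ℕ} : LinearOrder (Letter m n) :=
  LinearOrder.lift' key key_injective

/-- Membership in `B₁ = {1°, …, n°}`; `B₀` consists of the letters that are not in `B₁`. -/
def InB1 {m n : ℕ} : Letter m n → Prop
  | circ _ => True
  | _ => False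

end Letter

/-- A filling of boxes of the quarter plane; `T i j` is the entry in row `i` and column `j`
(both counted from zero, rows downwards), and `none` means that there is no box, or an
empty box, in that position. -/
abbrev Filling (m n : ℕ) : Type := ℕ → ℕ → Option (Letter m n)

/-- `T` is an `spo(2m,n)`-tableau of shape `lam`. -/
structure IsSpoTableau {m n : ℕ} (lam : YoungDiagram) (T : Filling m n) : Prop where
  /-- the boxes of `T` are those of `lam` -/
  shape : ∀ i j, (i, j) ∈ lam ↔ ∃ a, T i j = some a
  /-- the entries from `B₀` fill a Young diagram -/
  even_shape : ∃ mu : YoungDiagram, ∀ i j, (i, j) ∈ mu ↔ ∃ a, T i j = some a ∧ ¬ a.InB1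
  /-- the part in `B₀` has weakly increasing rows -/
  even_row : ∀ i j j' a b, j < j' → T i j = some a → T i j' = some b →
    ¬ a.InB1 → ¬ b.InB1 → a ≤ b
  /-- the part in `B₀` has strictly increasing columns -/
  even_col : ∀ i i' j a b, i < i' → T i j = some a → T i' j = some b →
    ¬ a.InB1 → ¬ b.InB1 → a < b
  /-- the symplectic condition: the entries from `B₀` in the row with index `i`, the `(i+1)`-st
  row, are at least the letter `i + 1` -/
  symplectic : ∀ i j a, T i j = some a → ¬ a.InB1 → 2 * i ≤ a.key
  /-- the part in `B₁` has strictly increasing rows -/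
  odd_row : ∀ i j j' a b, j < j' → T i j = some a → T i j' = some b →
    a.InB1 → b.InB1 → a < b
  /-- the part in `B₁` has weakly increasing columns -/
  odd_col : ∀ i i' j a b, i < i' → T i j = some a → T i' j = some b →
    a.InB1 → b.InB1 → a ≤ b

/-- The filling `T` with the content of the box `(i, j)` replaced by `v`. -/
def Filling.set {m n : ℕ} (T : Filling m n) (i j : ℕ) (v : Option (Letter m n)) : Filling m n :=
  fun i' j' => if i' = i ∧ j' = j then v else T i' j'

/-- Jeu de taquin: `Slide T i j S` says that moving the empty box at `(i, j)` of `T` by forward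
slides, until there is no box to the right of it and no box below it, ends in `S`. At that moment
the empty box is dropped. -/
inductive Slide {m n : ℕ} : Filling m n → ℕ → ℕ → Filling m n → Prop
  | halt {T : Filling m n} {i j : ℕ} (hr : T i (j + 1) = none) (hb : T (i + 1) j = none) :
      Slide T i j T
  | right {T S : Filling m n} {i j : ℕ} {a : Letter m n} (hr : T i (j + 1) = some a)
      (hb : ∀ b, T (i + 1) j = some b → a < b ∨ (a = b ∧ a.InB1))
      (h : Slide ((T.set i j (some a)).set i (j + 1) none) i (j + 1) S) : Slide T i j S
  | down {T S : Filling m n} {i j : ℕ} {b : Letter m n} (hb : T (i + 1) j = some b)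
      (hr : ∀ a, T i (j + 1) = some a → b < a ∨ (a = b ∧ ¬ a.InB1))
      (h : Slide ((T.set i j (some b)).set (i + 1) j none) (i + 1) j S) : Slide T i j S

/-- The first place in a row or column `r` of a tableau that holds an entry greater than `x`,
or the first place after the end of `r` if there is no such entry. -/
noncomputable def bumpIndex {m n : ℕ} (r : ℕ → Option (Letter m n)) (x : Letter m n) : ℕ :=
  sInf {j | ∀ y, r j = some y → x < y}

open Classical in
/-- The box that `x` enters when it is inserted into the row with index `p` of `T`, if `x ∈ B₀`,
or into the column with index `p` of `T`, if `x ∈ B₁`. -/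
noncomputable def target {m n : ℕ} (T : Filling m n) (x : Letter m n) (p : ℕ) : ℕ × ℕ :=
  if x.InB1 then (bumpIndex (fun i => T i p) x, p) else (p, bumpIndex (fun j => T p j) x)

/-- Replacing `y` by `x` in the row with index `p` is a cancellation: for some `i`, the letter
`i` would replace `ī` in the `i`-th row. -/
def Cancels {m n : ℕ} (x y : Letter m n) (p : ℕ) : Prop :=
  ∃ i : Fin m, x = Letter.plain i ∧ y = Letter.bar i ∧ p = (i : ℕ)

/-- `InsertAt T x p S` says that the insertion of `x` into the row with index `p` of `T` if
`x ∈ B₀`, or into the column with index `p` of `T` if `x ∈ B₁`, ends in `S`. A displaced entry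
from `B₀` is inserted into the subsequent row, a displaced entry from `B₁` into the subsequent
column, and an empty box left by a cancellation is moved out by jeu de taquin. -/
inductive InsertAt {m n : ℕ} : Filling m n → Letter m n → ℕ → Filling m n → Prop
  | land {T : Filling m n} {x : Letter m n} {p i j : ℕ} (hij : target T x p = (i, j))
      (hy : T i j = none) : InsertAt T x p (T.set i j (some x))
  | cancel {T S : Filling m n} {x y : Letter m n} {p i j : ℕ} (hij : target T x p = (i, j))
      (hy : T i j = some y) (hc : Cancels x y i) (h : Slide (T.set i j none) i j S) :
      InsertAt T x p S
  | bump_even {T S : Filling m n} {x y : Letter m n} {p i j : ℕ} (hij : target T x p = (i, j))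
      (hy : T i j = some y) (hc : ¬ Cancels x y i) (hb : ¬ y.InB1)
      (h : InsertAt (T.set i j (some x)) y (i + 1) S) : InsertAt T x p S
  | bump_odd {T S : Filling m n} {x y : Letter m n} {p i j : ℕ} (hij : target T x p = (i, j))
      (hy : T i j = some y) (hc : ¬ Cancels x y i) (hb : y.InB1)
      (h : InsertAt (T.set i j (some x)) y (j + 1) S) : InsertAt T x p S

/-- `InsertWord T w S` says that `S` arises from `T` by `spo`-insertion of the letters of `w`, the
head of `w` first. Every letter starts in the first row (`T ← x`, for `x ∈ B₀`) or in the first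
column (`x → T`, for `x ∈ B₁`). -/
inductive InsertWord {m n : ℕ} : Filling m n → List (Letter m n) → Filling m n → Prop
  | nil {T : Filling m n} : InsertWord T [] T
  | cons {T R S : Filling m n} {x : Letter m n} {w : List (Letter m n)}
      (hx : InsertAt T x 0 R) (hw : InsertWord R w S) : InsertWord T (x :: w) S

/-- The entries of the first `k` boxes of the first row of `U`, from left to right. -/
def rowWord {m n : ℕ} (U : Filling m n) (k : ℕ) : List (Letter m n) :=
  (List.range k).filterMap (U 0)

open Classical in
/-- If the first row of `U` is `a₁ ⋯ a_r b₁ ⋯ b_t` with `aᵢ ∈ B₀` and `bᵢ ∈ B₁`, this is the word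
`b_t ⋯ b₁ a₁ ⋯ a_r`. -/
noncomputable def productWord {m n : ℕ} (U : Filling m n) (k : ℕ) : List (Letter m n) :=
  ((rowWord U k).filter fun x => x.InB1).reverse ++ (rowWord U k).filter fun x => ¬ x.InB1

/-- `S` is the product `T · U = (b₁ → ⋯ → b_t → T) ← a₁ ← ⋯ ← a_r` of `T` and a one-row tableau
`U` with `k` boxes: first `b_t`, …, `b₁` are inserted, in this order, and then `a₁`, …, `a_r`. -/
def IsProduct {m n : ℕ} (T U : Filling m n) (k : ℕ) (S : Filling m n) : Prop :=
  InsertWord T (productWord U k) S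

theorem Slide.unique {m n : ℕ} {T S S' : Filling m n} {i j : ℕ} (h : Slide T i j S)
    (h' : Slide T i j S') : S = S' := by
  induction h with
  | halt hr hb => cases h' <;> simp_all
  | right hr hb _ ih =>
    cases h' with
    | halt hr' hb' => simp_all
    | right hr' hb' h2 =>
      rw [hr] at hr'
      cases hr'
      exact ih h2
    | down hb' hr' h2 =>
      rcases hb _ hb' with h1 | ⟨h1, h3⟩ <;> rcases hr' _ hr with h4 | ⟨h4, h5⟩
      · exact absurd h1 h4.asymm
      · exact absurd h4 h1.ne
      · exact absurd h1.symm h4.ne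
      · exact absurd h3 h5
  | down hb hr _ ih =>
    cases h' with
    | halt hr' hb' => simp_all
    | down hb' hr' h2 =>
      rw [hb] at hb'
      cases hb'
      exact ih h2
    | right hr' hb' h2 =>
      rcases hb' _ hb with h1 | ⟨h1, h3⟩ <;> rcases hr _ hr' with h4 | ⟨h4, h5⟩
      · exact absurd h1 h4.asymm
      · exact absurd h4 h1.ne
      · exact absurd h1.symm h4.ne
      · exact absurd h3 h5

theorem InsertAt.unique {m n : ℕ} {T S S' : Filling m n} {x : Letter m n} {p : ℕ}
    (h : InsertAt T x p S) (h' : InsertAt T x p S') : S = S' := by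
  induction h with
  | land hij hy =>
    cases h' with
    | land hij' hy' => rw [hij] at hij'; cases hij'; rfl
    | cancel hij' hy' hc' h2 => rw [hij] at hij'; cases hij'; simp_all
    | bump_even hij' hy' hc' hb' h2 => rw [hij] at hij'; cases hij'; simp_all
    | bump_odd hij' hy' hc' hb' h2 => rw [hij] at hij'; cases hij'; simp_all
  | cancel hij hy hc h =>
    cases h' with
    | cancel hij' hy' hc' h2 => rw [hij] at hij'; cases hij'; exact h.unique h2
    | land hij' hy' => rw [hij] at hij'; cases hij'; simp_all
    | bump_even hij' hy' hc' hb' h2 => rw [hij] at hij'; cases hij'; simp_all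
    | bump_odd hij' hy' hc' hb' h2 => rw [hij] at hij'; cases hij'; simp_all
  | bump_even hij hy hc hb _ ih =>
    cases h' with
    | bump_even hij' hy' hc' hb' h2 =>
      rw [hij] at hij'; cases hij'; rw [hy] at hy'; cases hy'; exact ih h2
    | land hij' hy' => rw [hij] at hij'; cases hij'; simp_all
    | cancel hij' hy' hc' h2 => rw [hij] at hij'; cases hij'; simp_all
    | bump_odd hij' hy' hc' hb' h2 => rw [hij] at hij'; cases hij'; simp_all
  | bump_odd hij hy hc hb _ ih =>
    cases h' with
    | bump_odd hij' hy' hc' hb' h2 =>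
      rw [hij] at hij'; cases hij'; rw [hy] at hy'; cases hy'; exact ih h2
    | land hij' hy' => rw [hij] at hij'; cases hij'; simp_all
    | cancel hij' hy' hc' h2 => rw [hij] at hij'; cases hij'; simp_all
    | bump_even hij' hy' hc' hb' h2 => rw [hij] at hij'; cases hij'; simp_all

/-- The product is determined by its factors. -/
theorem IsProduct.unique {m n : ℕ} {T U S S' : Filling m n} {k : ℕ} (h : IsProduct T U k S)
    (h' : IsProduct T U k S') : S = S' := by
  unfold IsProduct at h h'
  generalize productWord U k = w at h h'
  induction h with
  | nil => cases h'; rfl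
  | cons hx _ ih =>
    cases h' with
    | cons hx' hw' =>
      cases hx.unique hx'
      exact ih hw'

/-- The Young diagram of the one-row partition `(k)`. -/
def oneRow (k : ℕ) : YoungDiagram where
  cells := {0} ×ˢ Finset.range k
  isLowerSet := by
    rintro ⟨a, b⟩ ⟨c, d⟩ h hm
    simp only [Finset.coe_product, Set.mem_prod, Finset.mem_coe, Finset.mem_singleton,
      Finset.mem_range, Prod.mk_le_mk] at h hm ⊢
    omega

/-- The boxes of the skew diagram `lam / mu`, where `mu ⊆ lam`. -/
def skew (lam mu : YoungDiagram) : Finset (ℕ × ℕ) := lam.cells \ mu.cells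

/-- `lam / mu` is a horizontal strip: `mu ⊆ lam` and no two boxes of `lam / mu` are in the same
column. -/
def IsHorizontalStrip (lam mu : YoungDiagram) : Prop :=
  mu ≤ lam ∧ ∀ p ∈ skew lam mu, ∀ q ∈ skew lam mu, p.2 = q.2 → p = q

/-- `(lam, mu, nu)` is an `sp`-bumping sequence. -/
def IsSpBumpingSequence (lam mu nu : YoungDiagram) : Prop :=
  IsHorizontalStrip lam mu ∧ IsHorizontalStrip nu mu

end Spo

/-! An insertion is followed through the alphabet instead of through the boxes. For each `l`, `level
T l` is the diagram of the entries with key less than `l`. One insertion leaves such a diagram alone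
or changes it by one box; this is recorded as an `Edge`, and the edges at `l` and `l + 1` are linked
by the local rules `Step`. Cancellations fit in because a slide, seen only by small letters, is the
same slide stopped earlier (`SlideTrace`). `exists_insert` provides the result together with its
edges.

For two successive insertions, the possible pairs of edges are controlled by induction on `l`:
`EvenPair` up to `2 * m`, `OddPair` from there on. At the top this says: the letters of `B₁`,
inserted in decreasing order, add boxes in columns moving right; the letters of `B₀` first delete
boxes in columns moving left and then add boxes in columns moving right; and an addition directly
followed by a deletion cannot have both boxes in the first row. The last addition for `B₁` and the
first addition for `B₀` may be separated by deletions; `Run.col_lt` compares their columns.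

So the shape passes through `A ⊆ B ⊇ C ⊆ D`, each step a horizontal strip. A local rule on row
lengths replaces `A ⊆ B ⊇ C` by `A ⊇ mu ⊆ C`. The first-row condition keeps the sizes of the strips,
and the column condition makes `D / mu` a horizontal strip. The number `ℓ` counts the deletions. -/

namespace Spo

variable {m n : ℕ}

/-! ### Letters through their keys, and order conditions uniform in `B₀` and `B₁` -/

namespace Letter

theorem key_plain (i : Fin m) : (plain i : Letter m n).key = 2 * (i : ℕ) := rfl

theorem key_bar (i : Fin m) : (bar i : Letter m n).key = 2 * (i : ℕ) + 1 := rfl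

theorem lt_iff_key {a b : Letter m n} : a < b ↔ a.key < b.key := Iff.rfl

theorem le_iff_key {a b : Letter m n} : a ≤ b ↔ a.key ≤ b.key := Iff.rfl

theorem inB1_iff_key {a : Letter m n} : a.InB1 ↔ 2 * m ≤ a.key := by
  cases a with
  | plain i => have := i.isLt; simp only [InB1, key, false_iff]; omega
  | bar i => have := i.isLt; simp only [InB1, key, false_iff]; omega
  | circ j => simp only [InB1, key, true_iff]; omega

theorem key_lt (a : Letter m n) : a.key < 2 * m + n := by
  cases a with
  | plain i => have := i.isLt; simp only [key]; omega
  | bar i => have := i.isLt; simp only [key]; omega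
  | circ j => have := j.isLt; simp only [key]; omega

theorem eq_iff_key {a b : Letter m n} : a = b ↔ a.key = b.key :=
  ⟨fun h => h ▸ rfl, fun h => key_injective h⟩

end Letter

/-- The relation between two entries of a row, the left one being `a`. -/
def RowLe (a b : Letter m n) : Prop := a < b ∨ (a = b ∧ ¬ a.InB1)

/-- The relation between two entries of a column, the upper one being `a`. -/
def ColLe (a b : Letter m n) : Prop := a < b ∨ (a = b ∧ a.InB1)

theorem rowLe_iff {a b : Letter m n} :
    RowLe a b ↔ a.key < b.key ∨ (a.key = b.key ∧ a.key < 2 * m) := by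
  rw [RowLe, Letter.lt_iff_key, Letter.eq_iff_key, Letter.inB1_iff_key, not_le]

theorem colLe_iff {a b : Letter m n} :
    ColLe a b ↔ a.key < b.key ∨ (a.key = b.key ∧ 2 * m ≤ a.key) := by
  rw [ColLe, Letter.lt_iff_key, Letter.eq_iff_key, Letter.inB1_iff_key]

/-- The order conditions of an `spo`-tableau, for a filling of an arbitrary set of boxes. -/
structure IsArray (T : Filling m n) : Prop where
  row : ∀ {i j j' a b}, j < j' → T i j = some a → T i j' = some b → RowLe a b
  col : ∀ {i i' j a b}, i < i' → T i j = some a → T i' j = some b → ColLe a b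
  sympl : ∀ {i j a}, T i j = some a → a.key < 2 * m → 2 * i ≤ a.key

/-- All of `B₀` precedes `B₁`, so requiring the `B₀`-boxes to form a diagram amounts to weak
increase across the boundary between the two parts. Row and column conditions then merge into
`RowLe` and `ColLe`, which differ only in where equality is allowed. -/
theorem isSpoTableau_iff {lam : YoungDiagram} {T : Filling m n} :
    IsSpoTableau lam T ↔ IsArray T ∧ ∀ i j, (i, j) ∈ lam ↔ ∃ a, T i j = some a := by
  constructor
  · intro h
    obtain ⟨mu, hmu⟩ := h.even_shape
    have down : ∀ {i j i' j' a b}, i ≤ i' → j ≤ j' → T i j = some a → T i' j' = some b →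
        ¬ b.InB1 → ¬ a.InB1 := by
      intro i j i' j' a b hi hj ha hb hb1
      obtain ⟨a', ha', h1⟩ := (hmu i j).1 (mu.up_left_mem hi hj ((hmu i' j').2 ⟨b, hb, hb1⟩))
      rw [ha] at ha'
      cases ha'
      exact h1
    refine ⟨⟨?_, ?_, ?_⟩, h.shape⟩
    · intro i j j' a b hj ha hb
      have h1 := down le_rfl hj.le ha hb
      have h2 := h.even_row i j j' a b hj ha hb
      have h3 := h.odd_row i j j' a b hj ha hb
      rw [rowLe_iff]
      rw [Letter.lt_iff_key] at h3
      rw [Letter.le_iff_key] at h2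
      simp only [Letter.inB1_iff_key] at *
      omega
    · intro i i' j a b hj ha hb
      have h1 := down hj.le le_rfl ha hb
      have h2 := h.even_col i i' j a b hj ha hb
      have h3 := h.odd_col i i' j a b hj ha hb
      rw [colLe_iff]
      rw [Letter.le_iff_key] at h3
      rw [Letter.lt_iff_key] at h2
      simp only [Letter.inB1_iff_key] at *
      omega
    · intro i j a ha h1
      exact h.symplectic i j a ha (by rw [Letter.inB1_iff_key]; omega)
  · rintro ⟨h, hs⟩
    refine ⟨hs, ?_, ?_, ?_, ?_, ?_, ?_⟩
    · classical
      refine ⟨⟨lam.cells.filter fun c => ∃ a, T c.1 c.2 = some a ∧ ¬ a.InB1, ?_⟩, ?_⟩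
      · rintro ⟨i, j⟩ ⟨i', j'⟩ hle hm
        obtain ⟨hi, hj⟩ : i' ≤ i ∧ j' ≤ j := hle
        simp only [Finset.coe_filter, YoungDiagram.mem_cells, Set.mem_ofPred_eq] at hm ⊢
        obtain ⟨hm, a, ha, h1⟩ := hm
        have hm' := lam.up_left_mem hi hj hm
        refine ⟨hm', ?_⟩
        obtain ⟨a', ha'⟩ := (hs _ _).1 hm'
        obtain ⟨c, hc⟩ := (hs i j').1 (lam.up_left_mem le_rfl hj hm)
        refine ⟨a', ha', ?_⟩
        have e1 : a'.key ≤ c.key := by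
          rcases hi.eq_or_lt with rfl | hi
          · rw [ha'] at hc; cases hc; rfl
          · have := colLe_iff.1 (h.col hi ha' hc); omega
        have e2 : c.key ≤ a.key := by
          rcases hj.eq_or_lt with rfl | hj
          · rw [ha] at hc; cases hc; rfl
          · have := rowLe_iff.1 (h.row hj hc ha); omega
        rw [Letter.inB1_iff_key] at h1 ⊢
        omega
      · intro i j
        rw [← YoungDiagram.mem_cells]
        simp only [Finset.mem_filter, YoungDiagram.mem_cells, hs]
        exact ⟨fun h => h.2, fun h => ⟨⟨h.choose, h.choose_spec.1⟩, h⟩⟩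
    · intro i j j' a b hj ha hb _ _
      have := rowLe_iff.1 (h.row hj ha hb)
      rw [Letter.le_iff_key]
      omega
    · intro i j j' a b hj ha hb h1 _
      have := colLe_iff.1 (h.col hj ha hb)
      rw [Letter.inB1_iff_key] at h1
      rw [Letter.lt_iff_key]
      omega
    · intro i j a ha h1
      rw [Letter.inB1_iff_key] at h1
      exact h.sympl ha (by omega)
    · intro i j j' a b hj ha hb h1 _
      have := rowLe_iff.1 (h.row hj ha hb)
      rw [Letter.inB1_iff_key] at h1
      rw [Letter.lt_iff_key]
      omega
    · intro i j j' a b hj ha hb _ _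
      have := colLe_iff.1 (h.col hj ha hb)
      rw [Letter.le_iff_key]
      omega

/-- `T` is an `spo`-tableau of some shape. -/
def IsTableau (T : Filling m n) : Prop := ∃ lam : YoungDiagram, IsSpoTableau lam T

namespace IsTableau

variable {T : Filling m n}

theorem isArray (hT : IsTableau T) : IsArray T :=
  let ⟨_, h⟩ := hT
  (isSpoTableau_iff.1 h).1

theorem exists_entry (hT : IsTableau T) {i j i' j' : ℕ} {a : Letter m n} (hi : i' ≤ i)
    (hj : j' ≤ j) (ha : T i j = some a) : ∃ b, T i' j' = some b ∧ b ≤ a := by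
  obtain ⟨lam, h⟩ := hT
  obtain ⟨h, hs⟩ := isSpoTableau_iff.1 h
  have hm : (i, j) ∈ lam := (hs _ _).2 ⟨a, ha⟩
  obtain ⟨b, hb⟩ := (hs _ _).1 (lam.up_left_mem hi hj hm)
  obtain ⟨c, hc⟩ := (hs i j').1 (lam.up_left_mem le_rfl hj hm)
  refine ⟨b, hb, ?_⟩
  have e1 : b.key ≤ c.key := by
    rcases hi.eq_or_lt with rfl | hi
    · rw [hb] at hc; cases hc; rfl
    · have := colLe_iff.1 (h.col hi hb hc); omega
  have e2 : c.key ≤ a.key := by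
    rcases hj.eq_or_lt with rfl | hj
    · rw [ha] at hc; cases hc; rfl
    · have := rowLe_iff.1 (h.row hj hc ha); omega
  exact e1.trans e2

end IsTableau

/-! ### The diagrams of the small letters -/

open Classical in
/-- The diagram of the entries of `T` whose key is less than `l`. -/
noncomputable def level (T : Filling m n) (l : ℕ) : YoungDiagram :=
  if h : ∃ mu : YoungDiagram, ∀ i j, (i, j) ∈ mu ↔ ∃ a, T i j = some a ∧ a.key < l
  then h.choose else ⊥

theorem mem_level {T : Filling m n} (hT : IsTableau T) {l i j : ℕ} :
    (i, j) ∈ level T l ↔ ∃ a, T i j = some a ∧ a.key < l := by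
  classical
  have h : ∃ mu : YoungDiagram, ∀ i j, (i, j) ∈ mu ↔ ∃ a, T i j = some a ∧ a.key < l := by
    obtain ⟨lam, h⟩ := id hT
    obtain ⟨-, hs⟩ := isSpoTableau_iff.1 h
    refine ⟨⟨lam.cells.filter fun c => ∃ a, T c.1 c.2 = some a ∧ a.key < l, ?_⟩, ?_⟩
    · rintro ⟨i, j⟩ ⟨i', j'⟩ hle hm
      obtain ⟨hi, hj⟩ : i' ≤ i ∧ j' ≤ j := hle
      simp only [Finset.coe_filter, YoungDiagram.mem_cells, Set.mem_ofPred_eq] at hm ⊢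
      obtain ⟨hm, a, ha, h1⟩ := hm
      obtain ⟨b, hb, hba⟩ := hT.exists_entry hi hj ha
      exact ⟨lam.up_left_mem hi hj hm, b, hb, lt_of_le_of_lt hba h1⟩
    · intro i j
      rw [← YoungDiagram.mem_cells]
      simp only [Finset.mem_filter, YoungDiagram.mem_cells, hs]
      exact ⟨fun h => h.2, fun h => ⟨⟨h.choose, h.choose_spec.1⟩, h⟩⟩
  rw [level, dif_pos h]
  exact h.choose_spec i j

namespace IsTableau

variable {T : Filling m n}

theorem level_top (hT : IsTableau T) {lam : YoungDiagram} (h : IsSpoTableau lam T) :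
    level T (2 * m + n) = lam := by
  ext ⟨i, j⟩
  rw [YoungDiagram.mem_cells, YoungDiagram.mem_cells, mem_level hT, h.shape]
  exact ⟨fun ⟨a, h, _⟩ => ⟨a, h⟩, fun ⟨a, h⟩ => ⟨a, h, a.key_lt⟩⟩

theorem rowLen_level_le (hT : IsTableau T) (l i : ℕ) :
    (level T l).rowLen i ≤ (level T (l + 1)).rowLen i := by
  by_contra! h
  have h1 := YoungDiagram.mem_iff_lt_rowLen.2 h
  obtain ⟨a, ha, hl⟩ := (mem_level hT).1 h1
  exact (lt_irrefl _ (YoungDiagram.mem_iff_lt_rowLen.1 ((mem_level hT).2 ⟨a, ha, by omega⟩)))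

theorem colLen_level_le (hT : IsTableau T) (l j : ℕ) :
    (level T l).colLen j ≤ (level T (l + 1)).colLen j := by
  by_contra! h
  have h1 := YoungDiagram.mem_iff_lt_colLen.2 h
  obtain ⟨a, ha, hl⟩ := (mem_level hT).1 h1
  exact (lt_irrefl _ (YoungDiagram.mem_iff_lt_colLen.1 ((mem_level hT).2 ⟨a, ha, by omega⟩)))

/-- A letter of `B₀` occurs at most once in a column, so consecutive levels differ by a horizontal
strip. -/
theorem rowLen_level_succ_le (hT : IsTableau T) {l : ℕ} (hl : l < 2 * m) (i : ℕ) :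
    (level T (l + 1)).rowLen (i + 1) ≤ (level T l).rowLen i := by
  by_contra! h
  obtain ⟨a, ha, h1⟩ := (mem_level hT).1 (YoungDiagram.mem_iff_lt_rowLen.2 h)
  obtain ⟨b, hb, -⟩ := hT.exists_entry (Nat.le_succ i) le_rfl ha
  have h2 := colLe_iff.1 (hT.isArray.col (Nat.lt_succ_self i) hb ha)
  exact (lt_irrefl _ (YoungDiagram.mem_iff_lt_rowLen.1 ((mem_level hT).2 ⟨b, hb, by omega⟩)))

/-- A letter of `B₁` occurs at most once in a row, so here consecutive levels differ by a vertical
strip. -/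
theorem colLen_level_succ_le (hT : IsTableau T) {l : ℕ} (hl : 2 * m ≤ l) (j : ℕ) :
    (level T (l + 1)).colLen (j + 1) ≤ (level T l).colLen j := by
  by_contra! h
  obtain ⟨a, ha, h1⟩ := (mem_level hT).1 (YoungDiagram.mem_iff_lt_colLen.2 h)
  obtain ⟨b, hb, -⟩ := hT.exists_entry le_rfl (Nat.le_succ j) ha
  have h2 := rowLe_iff.1 (hT.isArray.row (Nat.lt_succ_self j) hb ha)
  exact (lt_irrefl _ (YoungDiagram.mem_iff_lt_colLen.1 ((mem_level hT).2 ⟨b, hb, by omega⟩)))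

theorem lt_of_mem_level (hT : IsTableau T) {l i j : ℕ} (hl : l ≤ 2 * m)
    (h : (i, j) ∈ level T l) : 2 * i < l := by
  obtain ⟨a, ha, h1⟩ := (mem_level hT).1 h
  have := hT.isArray.sympl ha (by omega)
  omega

end IsTableau

/-- Strictness comes for free: equality in a row needs a letter of `B₀`, equality in a column a
letter of `B₁`. -/
theorem RowLe.trans_colLe {a b c : Letter m n} (h : RowLe a b) (h' : ColLe b c) :
    a.key < c.key := by
  rw [rowLe_iff] at h
  rw [colLe_iff] at h'
  omega

theorem ColLe.trans_rowLe {a b c : Letter m n} (h : ColLe a b) (h' : RowLe b c) :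
    a.key < c.key := by
  rw [colLe_iff] at h
  rw [rowLe_iff] at h'
  omega

theorem RowLe.trans {a b c : Letter m n} (h : RowLe a b) (h' : RowLe b c) : RowLe a c := by
  rw [rowLe_iff] at *
  omega

theorem ColLe.trans {a b c : Letter m n} (h : ColLe a b) (h' : ColLe b c) : ColLe a c := by
  rw [colLe_iff] at *
  omega

/-! ### Changing one box of a filling -/

theorem Filling.set_none_eq_some {T : Filling m n} {i j i' j' : ℕ} {b : Letter m n} :
    T.set i j none i' j' = some b ↔ ¬ (i' = i ∧ j' = j) ∧ T i' j' = some b := by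
  unfold Filling.set
  split_ifs with h <;> simp [h]

theorem Filling.set_some_eq_some {T : Filling m n} {i j i' j' : ℕ} {a b : Letter m n} :
    T.set i j (some a) i' j' = some b ↔
      (i' = i ∧ j' = j ∧ a = b) ∨ (¬ (i' = i ∧ j' = j) ∧ T i' j' = some b) := by
  unfold Filling.set
  split_ifs with h
  · simp [h]
  · simp only [h, not_false_eq_true, true_and]
    refine ⟨Or.inr, ?_⟩
    rintro (⟨h1, h2, -⟩ | h1)
    · exact absurd ⟨h1, h2⟩ h
    · exact h1

theorem Filling.set_set_comm {T : Filling m n} {i j i' j' : ℕ} {v w : Option (Letter m n)}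
    (h : ¬ (i = i' ∧ j = j')) : (T.set i j v).set i' j' w = (T.set i' j' w).set i j v := by
  funext x y
  unfold Filling.set
  split_ifs with h1 h2 h2
  · exact absurd ⟨h2.1.symm.trans h1.1, h2.2.symm.trans h1.2⟩ h
  all_goals rfl

theorem IsArray.set_none {T : Filling m n} (h : IsArray T) (i j : ℕ) :
    IsArray (T.set i j none) where
  row hj ha hb := h.row hj (Filling.set_none_eq_some.1 ha).2 (Filling.set_none_eq_some.1 hb).2
  col hj ha hb := h.col hj (Filling.set_none_eq_some.1 ha).2 (Filling.set_none_eq_some.1 hb).2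
  sympl ha := h.sympl (Filling.set_none_eq_some.1 ha).2

theorem IsArray.set_some {T : Filling m n} (h : IsArray T) {i j : ℕ} {a : Letter m n}
    (hl : ∀ j' b, j' < j → T i j' = some b → RowLe b a)
    (hr : ∀ j' b, j < j' → T i j' = some b → RowLe a b)
    (hu : ∀ i' b, i' < i → T i' j = some b → ColLe b a)
    (hd : ∀ i' b, i < i' → T i' j = some b → ColLe a b)
    (hs : a.key < 2 * m → 2 * i ≤ a.key) : IsArray (T.set i j (some a)) where
  row {i1 j1 j2 a1 b1} hj ha hb := by
    rw [Filling.set_some_eq_some] at ha hb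
    rcases ha with ⟨rfl, rfl, rfl⟩ | ⟨h1, ha⟩ <;> rcases hb with ⟨h2, rfl, rfl⟩ | ⟨h3, hb⟩
    · exact absurd hj (lt_irrefl _)
    · exact hr _ _ hj hb
    · exact hl _ _ hj (h2 ▸ ha)
    · exact h.row hj ha hb
  col {i1 i2 j1 a1 b1} hj ha hb := by
    rw [Filling.set_some_eq_some] at ha hb
    rcases ha with ⟨rfl, rfl, rfl⟩ | ⟨h1, ha⟩ <;> rcases hb with ⟨rfl, h2, rfl⟩ | ⟨h3, hb⟩
    · exact absurd hj (lt_irrefl _)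
    · exact hd _ _ hj hb
    · exact hu _ _ hj (h2 ▸ ha)
    · exact h.col hj ha hb
  sympl {i1 j1 a1} ha := by
    rw [Filling.set_some_eq_some] at ha
    rcases ha with ⟨rfl, rfl, rfl⟩ | ⟨h1, ha⟩
    · exact hs
    · exact h.sympl ha

/-! ### Jeu de taquin, level by level -/

/-- `G` is a tableau with a hole at `(i, j)`; together with the hole it has shape `lam`. -/
structure IsHoleTableau (lam : YoungDiagram) (G : Filling m n) (i j : ℕ) : Prop where
  isArray : IsArray G
  mem : (i, j) ∈ lam
  entry_iff : ∀ i' j', (∃ a, G i' j' = some a) ↔ (i', j') ∈ lam ∧ ¬ (i' = i ∧ j' = j)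

namespace IsHoleTableau

variable {lam : YoungDiagram} {G : Filling m n} {i j : ℕ}

/-- Only column `j` needs an argument. Entries above the hole are compared with `a` through column
`j + 1`, where strictness comes from `RowLe.trans_colLe`; entries below are reached through the one
directly below the hole. -/
theorem right (h : IsHoleTableau lam G i j) {a : Letter m n} (ha : G i (j + 1) = some a)
    (hb : ∀ b, G (i + 1) j = some b → ColLe a b) :
    IsHoleTableau lam ((G.set i j (some a)).set i (j + 1) none) i (j + 1) := by
  have hm := ((h.entry_iff _ _).1 ⟨a, ha⟩).1
  refine ⟨?_, hm, ?_⟩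
  · rw [Filling.set_set_comm (by omega)]
    refine (h.isArray.set_none i (j + 1)).set_some ?_ ?_ ?_ ?_ ?_
    · intro j' b hj hb
      exact h.isArray.row (by omega) (Filling.set_none_eq_some.1 hb).2 ha
    · intro j' b hj hb
      rw [Filling.set_none_eq_some] at hb
      exact h.isArray.row (by omega) ha hb.2
    · intro i' b hi hb
      replace hb := (Filling.set_none_eq_some.1 hb).2
      obtain ⟨x, hx⟩ := (h.entry_iff i' (j + 1)).2
        ⟨lam.up_left_mem hi.le le_rfl hm, by omega⟩
      have := (h.isArray.row (Nat.lt_succ_self j) hb hx).trans_colLe (h.isArray.col hi hx ha)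
      exact colLe_iff.2 (Or.inl this)
    · intro i' b hi hb'
      replace hb' := (Filling.set_none_eq_some.1 hb').2
      have hm' := ((h.entry_iff _ _).1 ⟨b, hb'⟩).1
      obtain ⟨y, hy⟩ := (h.entry_iff (i + 1) j).2
        ⟨lam.up_left_mem hi le_rfl hm', by omega⟩
      rcases (Nat.succ_le_of_lt hi).eq_or_lt with rfl | hi
      · exact hb _ hb'
      · exact (hb y hy).trans (h.isArray.col hi hy hb')
    · exact fun h1 => h.isArray.sympl ha h1
  · intro i' j'
    simp only [Filling.set_none_eq_some, Filling.set_some_eq_some]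
    have := h.entry_iff i' j'
    constructor
    · rintro ⟨b, h1, ⟨rfl, rfl, rfl⟩ | ⟨h2, h3⟩⟩
      · exact ⟨h.mem, by omega⟩
      · exact ⟨(this.1 ⟨b, h3⟩).1, h1⟩
    · rintro ⟨h1, h2⟩
      by_cases h3 : i' = i ∧ j' = j
      · exact ⟨a, h2, Or.inl ⟨h3.1, h3.2, rfl⟩⟩
      · obtain ⟨b, hb⟩ := this.2 ⟨h1, h3⟩
        exact ⟨b, h2, Or.inr ⟨h3, hb⟩⟩

theorem down (h : IsHoleTableau lam G i j) {a : Letter m n} (ha : G (i + 1) j = some a)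
    (hb : ∀ b, G i (j + 1) = some b → RowLe a b) :
    IsHoleTableau lam ((G.set i j (some a)).set (i + 1) j none) (i + 1) j := by
  have hm := ((h.entry_iff _ _).1 ⟨a, ha⟩).1
  refine ⟨?_, hm, ?_⟩
  · rw [Filling.set_set_comm (by omega)]
    refine (h.isArray.set_none (i + 1) j).set_some ?_ ?_ ?_ ?_ ?_
    · intro j' b hj hb
      replace hb := (Filling.set_none_eq_some.1 hb).2
      obtain ⟨x, hx⟩ := (h.entry_iff (i + 1) j').2
        ⟨lam.up_left_mem le_rfl hj.le hm, by omega⟩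
      have := (h.isArray.col (Nat.lt_succ_self i) hb hx).trans_rowLe (h.isArray.row hj hx ha)
      exact rowLe_iff.2 (Or.inl this)
    · intro j' b hj hb'
      replace hb' := (Filling.set_none_eq_some.1 hb').2
      have hm' := ((h.entry_iff _ _).1 ⟨b, hb'⟩).1
      obtain ⟨y, hy⟩ := (h.entry_iff i (j + 1)).2
        ⟨lam.up_left_mem le_rfl hj hm', by omega⟩
      rcases (Nat.succ_le_of_lt hj).eq_or_lt with rfl | hj
      · exact hb _ hb'
      · exact (hb y hy).trans (h.isArray.row hj hy hb')
    · intro i' b hi hb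
      exact h.isArray.col (by omega) (Filling.set_none_eq_some.1 hb).2 ha
    · intro i' b hi hb
      rw [Filling.set_none_eq_some] at hb
      exact h.isArray.col (by omega) ha hb.2
    · intro h1
      have := h.isArray.sympl ha h1
      omega
  · intro i' j'
    simp only [Filling.set_none_eq_some, Filling.set_some_eq_some]
    have := h.entry_iff i' j'
    constructor
    · rintro ⟨b, h1, ⟨rfl, rfl, rfl⟩ | ⟨h2, h3⟩⟩
      · exact ⟨h.mem, by omega⟩
      · exact ⟨(this.1 ⟨b, h3⟩).1, h1⟩
    · rintro ⟨h1, h2⟩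
      by_cases h3 : i' = i ∧ j' = j
      · exact ⟨a, h2, Or.inl ⟨h3.1, h3.2, rfl⟩⟩
      · obtain ⟨b, hb⟩ := this.2 ⟨h1, h3⟩
        exact ⟨b, h2, Or.inr ⟨h3, hb⟩⟩

theorem isTableau (h : IsHoleTableau lam G i j) (hr : G i (j + 1) = none)
    (hb : G (i + 1) j = none) : IsTableau G := by
  have hr' : (i, j + 1) ∉ lam := fun hm => by
    obtain ⟨a, ha⟩ := (h.entry_iff _ _).2 ⟨hm, by omega⟩
    rw [hr] at ha
    cases ha
  have hb' : (i + 1, j) ∉ lam := fun hm => by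
    obtain ⟨a, ha⟩ := (h.entry_iff _ _).2 ⟨hm, by omega⟩
    rw [hb] at ha
    cases ha
  refine ⟨⟨lam.cells.erase (i, j), ?_⟩, ?_⟩
  · rintro ⟨a, b⟩ ⟨c, d⟩ hle hm
    obtain ⟨hc, hd⟩ : c ≤ a ∧ d ≤ b := hle
    simp only [Finset.coe_erase, Set.mem_sdiff, Finset.mem_coe, YoungDiagram.mem_cells,
      Set.mem_singleton_iff, Prod.mk.injEq] at hm ⊢
    refine ⟨lam.up_left_mem hc hd hm.1, ?_⟩
    rintro ⟨rfl, rfl⟩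
    rcases hc.eq_or_lt with rfl | hc
    · exact hr' (lam.up_left_mem le_rfl (by omega) hm.1)
    · exact hb' (lam.up_left_mem hc hd hm.1)
  · refine isSpoTableau_iff.2 ⟨h.isArray, fun i' j' => ?_⟩
    rw [h.entry_iff, ← YoungDiagram.mem_cells]
    simp only [Finset.mem_erase, YoungDiagram.mem_cells, ne_eq, Prod.mk.injEq]
    exact and_comm

end IsHoleTableau

/-- The box `c` of `T` has an entry whose key is less than `l`. -/
def Below (T : Filling m n) (l : ℕ) (c : ℕ × ℕ) : Prop := ∃ a, T c.1 c.2 = some a ∧ a.key < l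

/-- `S` arises from `G`, with a hole at `h`, by a slide; the restrictions to the entries whose key
is less than `l` differ by the box `d l`. -/
structure SlideTrace (G : Filling m n) (h : ℕ × ℕ) (S : Filling m n) (d : ℕ → ℕ × ℕ) : Prop where
  below_iff : ∀ l c, Below S l c ↔ (Below G l c ∨ c = h) ∧ c ≠ d l
  mem : ∀ l, Below G l (d l) ∨ d l = h
  mono : Monotone d
  le : ∀ l, h ≤ d l
  start : ∀ l, (∀ a, G h.1 (h.2 + 1) = some a → l ≤ a.key) →
    (∀ b, G (h.1 + 1) h.2 = some b → l ≤ b.key) → d l = h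

theorem SlideTrace.halt {G : Filling m n} {h : ℕ × ℕ} (hn : G h.1 h.2 = none) :
    SlideTrace G h G fun _ => h := by
  refine ⟨?_, fun _ => Or.inr rfl, fun _ _ _ => le_rfl, fun _ => le_rfl, fun _ _ _ => rfl⟩
  intro l c
  constructor
  · rintro hc
    refine ⟨Or.inl hc, ?_⟩
    rintro rfl
    obtain ⟨a, ha, -⟩ := hc
    rw [hn] at ha
    cases ha
  · rintro ⟨h1 | h1, h2⟩
    · exact h1
    · exact absurd h1 h2

/-- For `l ≤ a.key` the letter `a` is invisible, and by `hr` and `hb` so is the rest of the slide: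
at this level the hole never leaves `h`. For larger `l`, moving `a` just transfers the hole from `h`
to `h'`, and the rest of the slide decides. -/
theorem SlideTrace.step {G S : Filling m n} {h h' : ℕ × ℕ} {d : ℕ → ℕ × ℕ} {a : Letter m n}
    (hn : G h.1 h.2 = none) (ha : G h'.1 h'.2 = some a) (hne : h ≠ h') (hle : h ≤ h')
    (hr : ∀ b, G h'.1 (h'.2 + 1) = some b → a.key ≤ b.key)
    (hb : ∀ b, G (h'.1 + 1) h'.2 = some b → a.key ≤ b.key)
    (hnext : ∃ b, (G h.1 (h.2 + 1) = some b ∨ G (h.1 + 1) h.2 = some b) ∧ b.key = a.key)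
    (ht : SlideTrace ((G.set h.1 h.2 (some a)).set h'.1 h'.2 none) h' S d) :
    SlideTrace G h S fun l => if l ≤ a.key then h else d l := by
  set G' := (G.set h.1 h.2 (some a)).set h'.1 h'.2 none with hG'
  have hval : ∀ x y b, G' x y = some b ↔
      (x, y) ≠ h' ∧ (((x, y) = h ∧ a = b) ∨ ((x, y) ≠ h ∧ G x y = some b)) := by
    intro x y b
    rw [hG', Filling.set_none_eq_some, Filling.set_some_eq_some]
    simp only [ne_eq, Prod.ext_iff, and_assoc]
  have hmin : ∀ l ≤ a.key, d l = h' := by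
    intro l hl
    apply ht.start
    · intro b hb'
      rcases ((hval _ _ _).1 hb').2 with ⟨-, rfl⟩ | ⟨-, h2⟩
      · exact hl
      · exact hl.trans (hr _ h2)
    · intro b hb'
      rcases ((hval _ _ _).1 hb').2 with ⟨-, rfl⟩ | ⟨-, h2⟩
      · exact hl
      · exact hl.trans (hb _ h2)
  have low : ∀ l ≤ a.key, ∀ c, Below G' l c ↔ Below G l c := by
    rintro l hl ⟨x, y⟩
    constructor
    · rintro ⟨b, hb1, hb2⟩
      rcases (hval _ _ _).1 hb1 with ⟨h1, ⟨h2, rfl⟩ | ⟨h2, h3⟩⟩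
      · omega
      · exact ⟨b, h3, hb2⟩
    · rintro ⟨b, hb1, hb2⟩
      refine ⟨b, (hval _ _ _).2 ⟨?_, Or.inr ⟨?_, hb1⟩⟩, hb2⟩
      · rintro rfl
        rw [ha] at hb1
        cases hb1
        omega
      · rintro rfl
        rw [hn] at hb1
        cases hb1
  have high : ∀ l, a.key < l → ∀ c, (Below G' l c ∨ c = h') ↔ (Below G l c ∨ c = h) := by
    rintro l hl ⟨x, y⟩
    by_cases h1 : (x, y) = h'
    · simp only [h1, or_true, true_iff]
      exact Or.inl ⟨a, ha, hl⟩
    · by_cases h2 : (x, y) = h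
      · simp only [h2, or_true, iff_true]
        left
        refine ⟨a, (hval _ _ _).2 ⟨hne, Or.inl ⟨rfl, rfl⟩⟩, hl⟩
      · simp only [h1, h2, or_false]
        refine exists_congr fun b => and_congr_left fun _ => ?_
        rw [hval]
        simp [h1, h2]
  refine ⟨?_, ?_, ?_, ?_, ?_⟩
  · intro l c
    split_ifs with hl
    · rw [ht.below_iff, low l hl, hmin l hl]
      constructor
      · rintro ⟨h1 | h1, h2⟩
        · refine ⟨Or.inl h1, ?_⟩
          rintro rfl
          obtain ⟨b, hb1, -⟩ := h1
          rw [hn] at hb1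
          cases hb1
        · exact absurd h1 h2
      · rintro ⟨h1 | h1, h2⟩
        · refine ⟨Or.inl h1, ?_⟩
          rintro rfl
          obtain ⟨b, hb1, hb2⟩ := h1
          rw [ha] at hb1
          cases hb1
          omega
        · exact absurd h1 h2
    · rw [ht.below_iff, high l (by omega)]
  · intro l
    split_ifs with hl
    · exact Or.inr rfl
    · exact (high l (by omega) _).1 (ht.mem l)
  · intro l l' hll
    beta_reduce
    split_ifs with h1 h2 h2
    · exact le_rfl
    · exact hle.trans (ht.le _)
    · omega
    · exact ht.mono hll
  · intro l
    split_ifs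
    · exact le_rfl
    · exact hle.trans (ht.le _)
  · intro l h1 h2
    rw [if_pos]
    obtain ⟨b, hb1 | hb1, hb2⟩ := hnext
    · exact hb2 ▸ h1 _ hb1
    · exact hb2 ▸ h2 _ hb1

/-- Every move increases `i + j`, which stays below the sum of the first row and column lengths, so
`N` bounds the remaining moves. When both neighbours exist, the two rules are complementary: the
failure of `ColLe a b` is `RowLe b a`. -/
theorem IsHoleTableau.exists_slide {lam : YoungDiagram} (N : ℕ) : ∀ {G : Filling m n} {i j : ℕ},
    IsHoleTableau lam G i j → lam.rowLen 0 + lam.colLen 0 ≤ i + j + N →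
    ∃ S d, Slide G i j S ∧ IsTableau S ∧ SlideTrace G (i, j) S d := by
  induction N with
  | zero =>
    intro G i j h hN
    have h1 := YoungDiagram.mem_iff_lt_rowLen.1 (lam.up_left_mem (Nat.zero_le i) le_rfl h.mem)
    have h2 := YoungDiagram.mem_iff_lt_colLen.1 (lam.up_left_mem le_rfl (Nat.zero_le j) h.mem)
    omega
  | succ N ih =>
    intro G i j h hN
    have hn : G i j = none := by
      by_contra h0
      obtain ⟨a, ha⟩ := Option.ne_none_iff_exists'.1 h0
      exact ((h.entry_iff _ _).1 ⟨a, ha⟩).2 ⟨rfl, rfl⟩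
    have goRight : ∀ a, G i (j + 1) = some a → (∀ b, G (i + 1) j = some b → ColLe a b) →
        ∃ S d, Slide G i j S ∧ IsTableau S ∧ SlideTrace G (i, j) S d := by
      intro a ha hb
      obtain ⟨S, d, h1, h2, h3⟩ := ih (h.right ha hb) (by omega)
      refine ⟨S, _, Slide.right ha hb h1, h2,
        SlideTrace.step (h := (i, j)) (h' := (i, j + 1)) hn ha ?_ ?_ ?_ ?_ ?_ h3⟩
      · simp
      · exact ⟨le_rfl, Nat.le_succ j⟩
      · intro b hb
        have := rowLe_iff.1 (h.isArray.row (Nat.lt_succ_self _) ha hb)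
        omega
      · intro b hb
        have := colLe_iff.1 (h.isArray.col (Nat.lt_succ_self _) ha hb)
        omega
      · exact ⟨a, Or.inl ha, rfl⟩
    have goDown : ∀ b, G (i + 1) j = some b → (∀ a, G i (j + 1) = some a → RowLe b a) →
        ∃ S d, Slide G i j S ∧ IsTableau S ∧ SlideTrace G (i, j) S d := by
      intro b hb hr
      obtain ⟨S, d, h1, h2, h3⟩ := ih (h.down hb hr) (by omega)
      have hr' : ∀ a, G i (j + 1) = some a → b < a ∨ (a = b ∧ ¬ a.InB1) := by
        intro a ha
        rcases hr a ha with h4 | ⟨rfl, h4⟩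
        · exact Or.inl h4
        · exact Or.inr ⟨rfl, h4⟩
      refine ⟨S, _, Slide.down hb hr' h1, h2,
        SlideTrace.step (h := (i, j)) (h' := (i + 1, j)) hn hb ?_ ?_ ?_ ?_ ?_ h3⟩
      · simp
      · exact ⟨Nat.le_succ i, le_rfl⟩
      · intro c hc
        have := rowLe_iff.1 (h.isArray.row (Nat.lt_succ_self _) hb hc)
        omega
      · intro c hc
        have := colLe_iff.1 (h.isArray.col (Nat.lt_succ_self _) hb hc)
        omega
      · exact ⟨b, Or.inr hb, rfl⟩
    rcases ha : G i (j + 1) with _ | a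
    · rcases hb : G (i + 1) j with _ | b
      · exact ⟨G, _, Slide.halt ha hb, h.isTableau ha hb, SlideTrace.halt hn⟩
      · exact goDown b hb fun a h0 => by simp [ha] at h0
    · rcases hb : G (i + 1) j with _ | b
      · exact goRight a ha fun b h0 => by simp [hb] at h0
      · by_cases hab : ColLe a b
        · refine goRight a ha fun b' h0 => ?_
          rw [hb] at h0
          cases h0
          exact hab
        · refine goDown b hb fun a' h0 => ?_
          rw [ha] at h0
          cases h0
          rw [colLe_iff] at hab
          rw [rowLe_iff]
          omega

theorem mem_level_iff_below {T : Filling m n} (hT : IsTableau T) {l : ℕ} {c : ℕ × ℕ} :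
    c ∈ level T l ↔ Below T l c := mem_level hT

theorem level_congr {T S : Filling m n} (hT : IsTableau T) (hS : IsTableau S) {l : ℕ}
    (h : ∀ c, Below T l c ↔ Below S l c) : level T l = level S l := by
  ext c
  rw [YoungDiagram.mem_cells, YoungDiagram.mem_cells, mem_level_iff_below hT,
    mem_level_iff_below hS, h]

/-! ### Insertion, level by level -/

/-- `Q` arises from `P` by adding the box `c`. -/
def AddsBox (P Q : YoungDiagram) (c : ℕ × ℕ) : Prop := c ∉ P ∧ ∀ x, x ∈ Q ↔ x ∈ P ∨ x = c

/-- The effect of an insertion on the shape formed by the smallest letters: nothing, nothing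
because of a cancellation, or the addition or deletion of the box in row `r` and column `c`. -/
inductive Edge : Type
  | none
  | canc
  | add (r c : ℕ)
  | del (r c : ℕ)

/-- `Q` arises from `P` by the change that the edge prescribes. -/
def Edge.Rel : Edge → YoungDiagram → YoungDiagram → Prop
  | none, P, Q => Q = P
  | canc, P, Q => Q = P
  | add r c, P, Q => AddsBox P Q (r, c)
  | del r c, P, Q => AddsBox Q P (r, c)

/-- How the effect of an insertion on the letters with key less than `l` may be related to its
effect on the letters with key at most `l`. -/
inductive Step (m l : ℕ) : Edge → Edge → Prop
  | stay {r c : ℕ} : Step m l (.add r c) (.add r c)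
  | even {r c c' : ℕ} (h : l < 2 * m) : Step m l (.add r c) (.add (r + 1) c')
  | odd {r r' c : ℕ} (h : 2 * m ≤ l) : Step m l (.add r c) (.add r' (c + 1))
  | del {r r' c c' : ℕ} (hr : r ≤ r') (hc : c ≤ c') : Step m l (.del r c) (.del r' c')
  | canc {r c : ℕ} (h : l < 2 * m) (hl : l = 2 * (r + 1)) : Step m l (.add r c) .canc
  | rem {r c : ℕ} (h : l < 2 * m) (hl : l = 2 * r + 1) : Step m l .canc (.del r c)

/-- The first effect of the insertion of `x` into the row or column with index `p`. -/
def Starts (x : Letter m n) (p : ℕ) (e : Edge) : Prop :=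
  (x.key < 2 * m ∧ ∃ c, e = .add p c) ∨ (2 * m ≤ x.key ∧ ∃ r, e = .add r p) ∨
    (x.key < 2 * m ∧ x.key = 2 * p ∧ e = .canc)

/-- `e l` is the effect on the letters with key less than `l` of an insertion of `x` into the row
or column with index `p` of `T` that ends in `S`. -/
structure Trace (T : Filling m n) (x : Letter m n) (p : ℕ) (S : Filling m n)
    (e : ℕ → Edge) : Prop where
  before : ∀ l ≤ x.key, e l = .none
  start : Starts x p (e (x.key + 1))
  step : ∀ l, x.key < l → Step m l (e l) (e (l + 1))
  rel : ∀ l, (e l).Rel (level T l) (level S l)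

/-- The box `(i, j)` may receive the letter `x`. -/
structure Fits (T : Filling m n) (x : Letter m n) (i j : ℕ) : Prop where
  left : ∀ j' < j, ∃ b, T i j' = some b ∧ RowLe b x
  up : ∀ i' < i, ∃ b, T i' j = some b ∧ ColLe b x
  lt : ∀ y, T i j = some y → x < y
  sympl : x.key < 2 * m → 2 * i ≤ x.key

/-- Whatever lies to the right of or below the box is at least its old entry, hence larger than `x`;
only the entries to the left and above need to be controlled by `Fits`. -/
theorem Fits.isTableau {T : Filling m n} (hT : IsTableau T) {x : Letter m n} {i j : ℕ}
    (h : Fits T x i j) : IsTableau (T.set i j (some x)) := by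
  obtain ⟨lam, hlam⟩ := id hT
  obtain ⟨hA, hs⟩ := isSpoTableau_iff.1 hlam
  refine ⟨⟨insert (i, j) lam.cells, ?_⟩, isSpoTableau_iff.2 ⟨hA.set_some ?_ ?_ ?_ ?_ h.sympl, ?_⟩⟩
  · rintro ⟨a, b⟩ ⟨c, d⟩ hle hm
    obtain ⟨hc, hd⟩ : c ≤ a ∧ d ≤ b := hle
    simp only [Finset.coe_insert, Set.mem_insert_iff, Finset.mem_coe, YoungDiagram.mem_cells,
      Prod.mk.injEq] at hm ⊢
    rcases hm with ⟨rfl, rfl⟩ | hm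
    · rcases hc.eq_or_lt with rfl | hc
      · rcases hd.eq_or_lt with rfl | hd
        · exact Or.inl ⟨rfl, rfl⟩
        · obtain ⟨b, hb, -⟩ := h.left d hd
          exact Or.inr ((hs _ _).2 ⟨b, hb⟩)
      · obtain ⟨b, hb, -⟩ := h.up c hc
        exact Or.inr (lam.up_left_mem le_rfl hd ((hs _ _).2 ⟨b, hb⟩))
    · exact Or.inr (lam.up_left_mem hc hd hm)
  · intro j' b hj hb
    obtain ⟨b', hb', h1⟩ := h.left j' hj
    rw [hb] at hb'
    cases hb'
    exact h1
  · intro j' b hj hb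
    obtain ⟨y, hy, hyb⟩ := hT.exists_entry le_rfl hj.le hb
    exact Or.inl ((h.lt y hy).trans_le hyb)
  · intro i' b hi hb
    obtain ⟨b', hb', h1⟩ := h.up i' hi
    rw [hb] at hb'
    cases hb'
    exact h1
  · intro i' b hi hb
    obtain ⟨y, hy, hyb⟩ := hT.exists_entry hi.le le_rfl hb
    exact Or.inl ((h.lt y hy).trans_le hyb)
  · intro i' j'
    rw [← YoungDiagram.mem_cells]
    simp only [Finset.mem_insert, YoungDiagram.mem_cells, Prod.mk.injEq, hs,
      Filling.set_some_eq_some]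
    constructor
    · rintro (⟨rfl, rfl⟩ | ⟨a, ha⟩)
      · exact ⟨x, Or.inl ⟨rfl, rfl, rfl⟩⟩
      · by_cases h0 : i' = i ∧ j' = j
        · exact ⟨x, Or.inl ⟨h0.1, h0.2, rfl⟩⟩
        · exact ⟨a, Or.inr ⟨h0, ha⟩⟩
    · rintro ⟨a, ⟨rfl, rfl, -⟩ | ⟨-, ha⟩⟩
      · exact Or.inl ⟨rfl, rfl⟩
      · exact Or.inr ⟨a, ha⟩

theorem Fits.below_of_le {T : Filling m n} {x : Letter m n} {i j l : ℕ} (h : Fits T x i j)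
    (hl : l ≤ x.key) (c : ℕ × ℕ) : Below (T.set i j (some x)) l c ↔ Below T l c := by
  obtain ⟨i', j'⟩ := c
  constructor
  · rintro ⟨b, hb, hbl⟩
    rcases Filling.set_some_eq_some.1 hb with ⟨-, -, rfl⟩ | ⟨-, h2⟩
    · omega
    · exact ⟨b, h2, hbl⟩
  · rintro ⟨b, hb, hbl⟩
    refine ⟨b, Filling.set_some_eq_some.2 (Or.inr ⟨?_, hb⟩), hbl⟩
    rintro ⟨rfl, rfl⟩
    have := Letter.lt_iff_key.1 (h.lt b hb)
    omega

theorem Filling.below_set_of_lt {T : Filling m n} {x : Letter m n} {i j l : ℕ}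
    (hl : x.key < l) (c : ℕ × ℕ) :
    Below (T.set i j (some x)) l c ↔ Below T l c ∨ c = (i, j) := by
  obtain ⟨i', j'⟩ := c
  rw [Prod.mk.injEq]
  constructor
  · rintro ⟨b, hb, hbl⟩
    rcases Filling.set_some_eq_some.1 hb with ⟨h1, h2, rfl⟩ | ⟨-, h2⟩
    · exact Or.inr ⟨h1, h2⟩
    · exact Or.inl ⟨b, h2, hbl⟩
  · intro h
    by_cases h0 : i' = i ∧ j' = j
    · exact ⟨x, Filling.set_some_eq_some.2 (Or.inl ⟨h0.1, h0.2, rfl⟩), hl⟩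
    · obtain ⟨b, hb, hbl⟩ := h.resolve_right h0
      exact ⟨b, Filling.set_some_eq_some.2 (Or.inr ⟨h0, hb⟩), hbl⟩

/-- The letter `x` may be inserted into the row with index `p` of `T`, if it is in `B₀`, or into
the column with index `p`, if it is in `B₁`. -/
def CanEnter (T : Filling m n) (x : Letter m n) (p : ℕ) : Prop :=
  (x.key < 2 * m ∧ 2 * p ≤ x.key ∧ ∃ j, (∀ y, T p j = some y → x < y) ∧
      ∀ i < p, ∃ z, T i j = some z ∧ z < x) ∨
    (2 * m ≤ x.key ∧ ∃ i, (∀ y, T i p = some y → x < y) ∧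
      ∀ j < p, ∃ z, T i j = some z ∧ z < x)

theorem bumpIndex_spec {r : ℕ → Option (Letter m n)} {x : Letter m n} {j0 : ℕ}
    (h0 : ∀ y, r j0 = some y → x < y) :
    bumpIndex r x ≤ j0 ∧ (∀ y, r (bumpIndex r x) = some y → x < y) ∧
      ∀ j < bumpIndex r x, ∃ b, r j = some b ∧ b ≤ x := by
  refine ⟨Nat.sInf_le h0, Nat.sInf_mem (s := {j | ∀ y, r j = some y → x < y}) ⟨j0, h0⟩, ?_⟩
  intro j hj
  have := Nat.notMem_of_lt_sInf hj
  simp only [Set.mem_ofPred_eq, not_forall, not_lt] at this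
  obtain ⟨b, hb, hbx⟩ := this
  exact ⟨b, hb, hbx⟩

/-- For `x` in `B₀`, the first larger entry lies weakly left of the witness column of `CanEnter`.
The entries above it are no larger than those above the witness, hence smaller than `x`. For `B₁`,
rows and columns change roles. -/
theorem CanEnter.exists_target {T : Filling m n} (hT : IsTableau T) {x : Letter m n} {p : ℕ}
    (h : CanEnter T x p) : ∃ i j, target T x p = (i, j) ∧ Fits T x i j ∧
      (x.key < 2 * m → i = p) ∧ (2 * m ≤ x.key → j = p) := by
  rcases h with ⟨hx, hp, j0, h1, h2⟩ | ⟨hx, i0, h1, h2⟩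
  · have hx' : ¬ x.InB1 := by rw [Letter.inB1_iff_key]; omega
    obtain ⟨h3, h4, h5⟩ := bumpIndex_spec (r := fun j => T p j) h1
    refine ⟨p, _, by rw [target, if_neg hx'], ⟨?_, ?_, h4, fun _ => hp⟩, fun _ => rfl, by omega⟩
    · intro j hj
      obtain ⟨b, hb, hbx⟩ := h5 j hj
      refine ⟨b, hb, ?_⟩
      rw [Letter.le_iff_key] at hbx
      rw [rowLe_iff]
      omega
    · intro i hi
      obtain ⟨z, hz, hzx⟩ := h2 i hi
      obtain ⟨b, hb, hbz⟩ := hT.exists_entry le_rfl h3 hz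
      exact ⟨b, hb, Or.inl (hbz.trans_lt hzx)⟩
  · have hx' : x.InB1 := by rw [Letter.inB1_iff_key]; omega
    obtain ⟨h3, h4, h5⟩ := bumpIndex_spec (r := fun i => T i p) h1
    refine ⟨_, p, by rw [target, if_pos hx'], ⟨?_, ?_, h4, by omega⟩, by omega, fun _ => rfl⟩
    · intro j hj
      obtain ⟨z, hz, hzx⟩ := h2 j hj
      obtain ⟨b, hb, hbz⟩ := hT.exists_entry h3 le_rfl hz
      exact ⟨b, hb, Or.inl (hbz.trans_lt hzx)⟩
    · intro i hi
      obtain ⟨b, hb, hbx⟩ := h5 i hi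
      refine ⟨b, hb, ?_⟩
      rw [Letter.le_iff_key] at hbx
      rw [colLe_iff]
      omega

theorem canEnter_zero {T : Filling m n} (hT : IsTableau T) (x : Letter m n) :
    CanEnter T x 0 := by
  obtain ⟨lam, hlam⟩ := hT
  rcases lt_or_ge x.key (2 * m) with hx | hx
  · refine Or.inl ⟨hx, by omega, lam.rowLen 0, fun y hy => ?_, by omega⟩
    have := YoungDiagram.mem_iff_lt_rowLen.1 ((hlam.shape _ _).2 ⟨y, hy⟩)
    omega
  · refine Or.inr ⟨hx, lam.colLen 0, fun y hy => ?_, by omega⟩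
    have := YoungDiagram.mem_iff_lt_colLen.1 ((hlam.shape _ _).2 ⟨y, hy⟩)
    omega

theorem addsBox_level {T S : Filling m n} (hT : IsTableau T) (hS : IsTableau S) {l : ℕ}
    {c : ℕ × ℕ} (hc : ¬ Below T l c) (h : ∀ x, Below S l x ↔ Below T l x ∨ x = c) :
    AddsBox (level T l) (level S l) c := by
  refine ⟨by rwa [mem_level_iff_below hT], fun x => ?_⟩
  rw [mem_level_iff_below hT, mem_level_iff_below hS, h]

theorem Fits.trace_of_none {T : Filling m n} (hT : IsTableau T) {x : Letter m n} {p i j : ℕ}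
    (h : Fits T x i j) (hi : x.key < 2 * m → i = p) (hj : 2 * m ≤ x.key → j = p)
    (hn : T i j = none) :
    Trace T x p (T.set i j (some x)) fun l => if l ≤ x.key then .none else .add i j := by
  refine ⟨fun l hl => if_pos hl, ?_, ?_, ?_⟩
  · rw [if_neg (by omega)]
    rcases lt_or_ge x.key (2 * m) with hx | hx
    · exact Or.inl ⟨hx, j, by rw [hi hx]⟩
    · exact Or.inr (Or.inl ⟨hx, i, by rw [hj hx]⟩)
  · intro l hl
    rw [if_neg (by omega), if_neg (by omega)]
    exact .stay
  · intro l
    have hS := h.isTableau hT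
    split_ifs with hl
    · exact level_congr hS hT (h.below_of_le hl)
    · refine addsBox_level hT hS ?_ (Filling.below_set_of_lt (by omega))
      rintro ⟨a, ha, -⟩
      rw [hn] at ha
      cases ha

/-- Up to the key of `y`, the insertion merely puts `x` into its box; beyond that it looks like the
insertion of `y`. The two descriptions meet at `l = y.key`, where the start of the second one gives
the required `Step`. -/
theorem Fits.trace_of_bump {T S : Filling m n} (hT : IsTableau T)
    {x y : Letter m n} {p p' i j : ℕ}
    (h : Fits T x i j) (hi : x.key < 2 * m → i = p) (hj : 2 * m ≤ x.key → j = p)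
    (hy : T i j = some y) {e : ℕ → Edge} (hi' : y.key < 2 * m → p' = i + 1)
    (hj' : 2 * m ≤ y.key → p' = j + 1) (ht : Trace (T.set i j (some x)) y p' S e) :
    Trace T x p S fun l =>
      if l ≤ y.key then (if l ≤ x.key then .none else .add i j) else e l := by
  have hxy := Letter.lt_iff_key.1 (h.lt y hy)
  refine ⟨fun l hl => by rw [if_pos (by omega), if_pos hl], ?_, ?_, ?_⟩
  · rw [if_pos (by omega), if_neg (by omega)]
    rcases lt_or_ge x.key (2 * m) with hx | hx
    · exact Or.inl ⟨hx, j, by rw [hi hx]⟩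
    · exact Or.inr (Or.inl ⟨hx, i, by rw [hj hx]⟩)
  · intro l hl
    rcases lt_trichotomy l y.key with hly | hly | hly
    · rw [if_pos (by omega), if_neg (by omega), if_pos (by omega), if_neg (by omega)]
      exact .stay
    · rw [if_pos (by omega), if_neg (by omega), if_neg (by omega), hly]
      rcases ht.start with ⟨h1, c, h2⟩ | ⟨h1, r, h2⟩ | ⟨h1, h2, h3⟩
      · rw [h2, hi' h1]
        exact .even h1
      · rw [h2, hj' h1]
        exact .odd h1
      · rw [h3]
        exact .canc h1 (by rw [h2, hi' h1])
    · rw [if_neg (by omega), if_neg (by omega)]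
      exact ht.step l hly
  · intro l
    have hT' := h.isTableau hT
    have hrel := ht.rel l
    split_ifs with hl hl'
    · rw [ht.before l hl] at hrel
      exact hrel.trans (level_congr hT' hT (h.below_of_le hl'))
    · rw [ht.before l hl] at hrel
      change level S l = _ at hrel
      change AddsBox _ (level S l) _
      rw [hrel]
      refine addsBox_level hT hT' ?_ (Filling.below_set_of_lt (by omega))
      rintro ⟨a, ha, hal⟩
      rw [hy] at ha
      cases ha
      omega
    -- A level that contains `y` does not notice that `x` takes its box.
    · rwa [level_congr hT' hT] at hrel
      intro c
      rw [Filling.below_set_of_lt (by omega), or_iff_left_iff_imp]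
      rintro rfl
      exact ⟨y, hy, by omega⟩

/-- Letters below `ī` do not see the hole, so their levels keep their shape. This includes the level
with `i` but without `ī`, whose edge `.canc` marks that `i` was discarded. Each higher level loses
the box at which the slide, restricted to it, ends. -/
theorem exists_trace_of_cancels {T : Filling m n} (hT : IsTableau T) {x y : Letter m n} {i j : ℕ}
    (hy : T i j = some y) (hc : Cancels x y i) :
    ∃ S e, Slide (T.set i j none) i j S ∧ IsTableau S ∧ Trace T x i S e := by
  obtain ⟨i0, rfl, rfl, rfl⟩ := hc
  have hi0 := i0.isLt
  obtain ⟨lam, hlam⟩ := id hT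
  obtain ⟨hA, hs⟩ := isSpoTableau_iff.1 hlam
  have hole : IsHoleTableau lam (T.set i0 j none) i0 j := by
    refine ⟨hA.set_none _ _, (hs _ _).2 ⟨_, hy⟩, fun i' j' => ?_⟩
    simp only [Filling.set_none_eq_some, hs]
    exact ⟨fun ⟨a, h1, h2⟩ => ⟨⟨a, h2⟩, h1⟩, fun ⟨⟨a, h2⟩, h1⟩ => ⟨a, h1, h2⟩⟩
  obtain ⟨S, d, h1, hS, h3⟩ := hole.exists_slide _ (Nat.le_add_left _ _)
  have hbelow : ∀ l c, Below (T.set i0 j none) l c ↔ Below T l c ∧ c ≠ ((i0 : ℕ), j) := by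
    rintro l ⟨i', j'⟩
    simp only [Below, Filling.set_none_eq_some, ne_eq, Prod.mk.injEq]
    exact ⟨fun ⟨a, ⟨h4, h5⟩, h6⟩ => ⟨⟨a, h5, h6⟩, h4⟩,
      fun ⟨⟨a, h5, h6⟩, h4⟩ => ⟨a, ⟨h4, h5⟩, h6⟩⟩
  have high : ∀ l, 2 * (i0 : ℕ) + 1 < l → ∀ c,
      (Below (T.set i0 j none) l c ∨ c = ((i0 : ℕ), j)) ↔ Below T l c := by
    intro l hl c
    rw [hbelow]
    by_cases hc : c = ((i0 : ℕ), j)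
    · subst hc
      simp only [or_true, true_iff]
      exact ⟨_, hy, hl⟩
    · simp [hc]
  have hmem : ∀ l, 2 * (i0 : ℕ) + 1 < l → Below T l (d l) := fun l hl =>
    (high l hl _).1 (h3.mem l)
  refine ⟨S, fun l => if l ≤ 2 * (i0 : ℕ) then .none else if l = 2 * (i0 : ℕ) + 1 then .canc
    else .del (d l).1 (d l).2, h1, hS, ⟨fun l hl => if_pos hl, ?_, ?_, ?_⟩⟩
  · refine Or.inr (Or.inr ⟨?_, rfl, ?_⟩)
    · simp only [Letter.key_plain]; omega
    · simp [Letter.key_plain]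
  · intro l hl
    simp only [Letter.key_plain] at hl
    rw [if_neg (by omega : ¬ l ≤ _), if_neg (by omega : ¬ l + 1 ≤ _),
      if_neg (by omega : ¬ l + 1 = _)]
    split_ifs with h4
    · refine .rem (by omega) ?_
      -- At the first level with `ī`, the slide cannot leave the row of the cancellation: the
      -- symplectic condition allows no entry up to `ī` further down.
      have h5 := hT.lt_of_mem_level (l := l + 1) (i := (d (l + 1)).1) (j := (d (l + 1)).2)
        (by omega)
        ((mem_level_iff_below hT).2 (hmem _ (by omega)))
      have h6 : (i0 : ℕ) ≤ (d (l + 1)).1 := (h3.le (l + 1)).1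
      omega
    · have h5 := h3.mono (Nat.le_succ l)
      exact .del h5.1 h5.2
  · intro l
    have low : l ≤ 2 * (i0 : ℕ) + 1 → level S l = level T l := by
      intro hl
      have hd : d l = ((i0 : ℕ), j) := by
        apply h3.start
        · intro a ha
          have := rowLe_iff.1 (hA.row (Nat.lt_succ_self j) hy (Filling.set_none_eq_some.1 ha).2)
          simp only [Letter.key_bar] at this
          omega
        · intro a ha
          have := colLe_iff.1 (hA.col (Nat.lt_succ_self i0) hy (Filling.set_none_eq_some.1 ha).2)
          simp only [Letter.key_bar] at this
          omega
      refine level_congr hS hT fun c => ?_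
      rw [h3.below_iff, hd, hbelow]
      constructor
      · rintro ⟨h4 | h4, h5⟩
        · exact h4.1
        · exact absurd h4 h5
      · intro h4
        have : c ≠ ((i0 : ℕ), j) := by
          rintro rfl
          obtain ⟨a, ha, hal⟩ := h4
          rw [hy] at ha
          cases ha
          simp only [Letter.key_bar] at hal
          omega
        exact ⟨Or.inl ⟨h4, this⟩, this⟩
    split_ifs with h4 h5
    · exact low (by omega)
    · exact low (by omega)
    · have hl : 2 * (i0 : ℕ) + 1 < l := by omega
      refine addsBox_level hS hT (c := d l) ?_ ?_
      · rw [h3.below_iff]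
        exact fun h => h.2 rfl
      · intro c
        rw [h3.below_iff, high l hl]
        by_cases hc : c = d l
        · simp [hc, hmem l hl]
        · simp [hc]

/-- Every letter can be inserted into a tableau. -/
theorem exists_insert (N : ℕ) : ∀ {T : Filling m n} {x : Letter m n} {p : ℕ}, IsTableau T →
    CanEnter T x p → 2 * m + n ≤ x.key + N →
    ∃ S e, InsertAt T x p S ∧ IsTableau S ∧ Trace T x p S e := by
  induction N with
  | zero =>
    intro T x p _ _ h
    have := x.key_lt
    omega
  | succ N ih =>
    -- `N` is a bound for the remaining bumps: each displaced letter has a larger key.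
    intro T x p hT hx hN
    obtain ⟨i, j, htar, hfit, hi, hj⟩ := hx.exists_target hT
    rcases hy : T i j with _ | y
    · exact ⟨_, _, .land htar hy, hfit.isTableau hT, hfit.trace_of_none hT hi hj hy⟩
    · have hxy := Letter.lt_iff_key.1 (hfit.lt y hy)
      have hA := hT.isArray
      have hat : T.set i j (some x) i j = some x := by simp [Filling.set]
      by_cases hc : Cancels x y i
      · obtain ⟨S, e, h1, h2, h3⟩ := exists_trace_of_cancels hT hy hc
        have hip : i = p := by
          obtain ⟨i0, rfl, -, -⟩ := hc
          refine hi ?_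
          have := i0.isLt
          simp only [Letter.key_plain]
          omega
        exact ⟨S, e, .cancel htar hy hc h1, h2, hip ▸ h3⟩
      · rcases lt_or_ge y.key (2 * m) with hym | hym
        · have hent : CanEnter (T.set i j (some x)) y (i + 1) := by
            refine Or.inl ⟨hym, ?_, j, ?_, ?_⟩
            · have h1 := hA.sympl hy hym
              have h2 := hfit.sympl (by omega)
              -- The cancellation rule is exactly what saves the symplectic condition: if `y` were
              -- too small for row `i + 1`, then `2 * i ≤ x.key < y.key < 2 * i + 2` would leave
              -- only the letter of that row and its barred version.
              by_contra h3
              apply hc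
              refine ⟨⟨i, by omega⟩, ?_, ?_, rfl⟩ <;> rw [Letter.eq_iff_key] <;>
                simp only [Letter.key_plain, Letter.key_bar] <;> omega
            · intro z hz
              rcases Filling.set_some_eq_some.1 hz with ⟨h1, -⟩ | ⟨-, hz⟩
              · omega
              · have := colLe_iff.1 (hA.col (Nat.lt_succ_self i) hy hz)
                rw [Letter.lt_iff_key]
                omega
            · intro i' hi'
              rcases (Nat.lt_succ_iff.1 hi').eq_or_lt with rfl | hi'
              · exact ⟨x, hat, hxy⟩
              · obtain ⟨b, hb, hbx⟩ := hfit.up i' hi'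
                refine ⟨b, Filling.set_some_eq_some.2 (Or.inr ⟨by omega, hb⟩), ?_⟩
                rw [colLe_iff] at hbx
                rw [Letter.lt_iff_key]
                omega
          obtain ⟨S, e, h1, h2, h3⟩ := ih (hfit.isTableau hT) hent (by omega)
          refine ⟨S, _, .bump_even htar hy hc (by rw [Letter.inB1_iff_key]; omega) h1, h2,
            hfit.trace_of_bump hT hi hj hy (fun _ => rfl) (by omega) h3⟩
        · have hent : CanEnter (T.set i j (some x)) y (j + 1) := by
            refine Or.inr ⟨hym, i, ?_, ?_⟩
            · intro z hz
              rcases Filling.set_some_eq_some.1 hz with ⟨-, h1, -⟩ | ⟨-, hz⟩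
              · omega
              · have := rowLe_iff.1 (hA.row (Nat.lt_succ_self j) hy hz)
                rw [Letter.lt_iff_key]
                omega
            · intro j' hj'
              rcases (Nat.lt_succ_iff.1 hj').eq_or_lt with rfl | hj'
              · exact ⟨x, hat, hxy⟩
              · obtain ⟨b, hb, hbx⟩ := hfit.left j' hj'
                refine ⟨b, Filling.set_some_eq_some.2 (Or.inr ⟨by omega, hb⟩), ?_⟩
                rw [rowLe_iff] at hbx
                rw [Letter.lt_iff_key]
                omega
          obtain ⟨S, e, h1, h2, h3⟩ := ih (hfit.isTableau hT) hent (by omega)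
          refine ⟨S, _, .bump_odd htar hy hc (by rw [Letter.inB1_iff_key]; omega) h1, h2,
            hfit.trace_of_bump hT hi hj hy (by omega) (fun _ => rfl) h3⟩

/-! ### Row and column lengths when one box is added -/

namespace AddsBox

variable {P Q : YoungDiagram} {r c : ℕ}

theorem rowLen_eq (h : AddsBox P Q (r, c)) : P.rowLen r = c := by
  have h1 : ¬ c < P.rowLen r := fun h1 => h.1 (YoungDiagram.mem_iff_lt_rowLen.2 h1)
  by_contra h2
  have h3 : (r, P.rowLen r) ∈ Q :=
    Q.up_left_mem le_rfl (by omega) ((h.2 (r, c)).2 (Or.inr rfl))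
  rcases (h.2 _).1 h3 with h4 | h4
  · exact lt_irrefl _ (YoungDiagram.mem_iff_lt_rowLen.1 h4)
  · rw [Prod.mk.injEq] at h4
    exact h2 h4.2

theorem colLen_eq (h : AddsBox P Q (r, c)) : P.colLen c = r := by
  have h1 : ¬ r < P.colLen c := fun h1 => h.1 (YoungDiagram.mem_iff_lt_colLen.2 h1)
  by_contra h2
  have h3 : (P.colLen c, c) ∈ Q :=
    Q.up_left_mem (by omega) le_rfl ((h.2 (r, c)).2 (Or.inr rfl))
  rcases (h.2 _).1 h3 with h4 | h4
  · exact lt_irrefl _ (YoungDiagram.mem_iff_lt_colLen.1 h4)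
  · rw [Prod.mk.injEq] at h4
    exact h2 h4.1

theorem rowLen_add (h : AddsBox P Q (r, c)) (i : ℕ) :
    Q.rowLen i = P.rowLen i + if i = r then 1 else 0 := by
  have h0 := h.rowLen_eq
  have key : ∀ j, j < Q.rowLen i ↔ j < P.rowLen i ∨ (i = r ∧ j = c) := by
    intro j
    rw [← YoungDiagram.mem_iff_lt_rowLen, ← YoungDiagram.mem_iff_lt_rowLen, h.2, Prod.mk.injEq]
  have h1 := key (Q.rowLen i)
  have h2 := key (P.rowLen i)
  have h3 := key (P.rowLen i + 1)
  split_ifs with hi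
  · subst hi
    omega
  · omega

theorem colLen_add (h : AddsBox P Q (r, c)) (j : ℕ) :
    Q.colLen j = P.colLen j + if j = c then 1 else 0 := by
  have h0 := h.colLen_eq
  have key : ∀ i, i < Q.colLen j ↔ i < P.colLen j ∨ (i = r ∧ j = c) := by
    intro i
    rw [← YoungDiagram.mem_iff_lt_colLen, ← YoungDiagram.mem_iff_lt_colLen, h.2, Prod.mk.injEq]
  have h1 := key (Q.colLen j)
  have h2 := key (P.colLen j)
  have h3 := key (P.colLen j + 1)
  split_ifs with hi
  · subst hi
    omega
  · omega

theorem rowLen_self (h : AddsBox P Q (r, c)) : Q.rowLen r = c + 1 := by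
  rw [h.rowLen_add, h.rowLen_eq, if_pos rfl]

theorem colLen_self (h : AddsBox P Q (r, c)) : Q.colLen c = r + 1 := by
  rw [h.colLen_add, h.colLen_eq, if_pos rfl]

theorem rowLen_of_ne (h : AddsBox P Q (r, c)) {i : ℕ} (hi : i ≠ r) :
    Q.rowLen i = P.rowLen i := by
  rw [h.rowLen_add, if_neg hi, add_zero]

theorem colLen_of_ne (h : AddsBox P Q (r, c)) {j : ℕ} (hj : j ≠ c) :
    Q.colLen j = P.colLen j := by
  rw [h.colLen_add, if_neg hj, add_zero]

theorem mem (h : AddsBox P Q (r, c)) : (r, c) ∈ Q := (h.2 _).2 (Or.inr rfl)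

end AddsBox

namespace Trace

variable {T S : Filling m n} {x : Letter m n} {p : ℕ} {e : ℕ → Edge}

theorem ne_none (h : Trace T x p S e) {l : ℕ} (hl : x.key < l) : e l ≠ .none := by
  intro h0
  have := h.step l hl
  rw [h0] at this
  cases this

/-- A cancellation edge must be followed by the removal of a barred letter, and there is none left
from level `2 * m` on. -/
theorem ne_canc (h : Trace T x p S e) {l : ℕ} (hl : 2 * m ≤ l) : e l ≠ .canc := by
  intro h0
  rcases le_or_gt l x.key with hx | hx
  · rw [h.before l hx] at h0
    cases h0
  · have h1 := h.step l hx
    rw [h0] at h1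
    generalize e (l + 1) = E at h1
    cases h1 with
    | rem h1 _ => omega

theorem rel_add (h : Trace T x p S e) {l r c : ℕ} (he : e l = .add r c) :
    AddsBox (level T l) (level S l) (r, c) := by
  have := h.rel l
  rwa [he] at this

theorem rel_del (h : Trace T x p S e) {l r c : ℕ} (he : e l = .del r c) :
    AddsBox (level S l) (level T l) (r, c) := by
  have := h.rel l
  rwa [he] at this

theorem rel_canc (h : Trace T x p S e) {l : ℕ} (he : e l = .canc) : level S l = level T l := by
  have := h.rel l
  rwa [he] at this

theorem rel_none (h : Trace T x p S e) {l : ℕ} (he : e l = .none) : level S l = level T l := by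
  have := h.rel l
  rwa [he] at this

theorem step_of_eq (h : Trace T x p S e) {l : ℕ} {e1 : Edge} (he : e l = e1) (h1 : e1 ≠ .none) :
    Step m l e1 (e (l + 1)) := by
  have hl : x.key < l := by
    by_contra h0
    rw [h.before l (by omega)] at he
    exact h1 he.symm
  exact he ▸ h.step l hl

/-- A deleted box moves at most one row down when an even letter is taken into account. -/
theorem del_row_le (h : Trace T x p S e) (hT : IsTableau T) {l r r' c c' : ℕ}
    (hl : l < 2 * m) (h1 : e l = .del r c) (h2 : e (l + 1) = .del r' c') (hc : c ≤ c') :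
    r' ≤ r + 1 := by
  by_contra! h0
  have a1 := h.rel_del h1
  have a2 := h.rel_del h2
  have b1 := a2.rowLen_self
  have b2 := (level T (l + 1)).rowLen_anti _ _ (show r + 1 + 1 ≤ r' by omega)
  have b3 := hT.rowLen_level_succ_le hl (r + 1)
  have b4 := a1.rowLen_of_ne (show r + 1 ≠ r by omega)
  have b5 := (level S l).rowLen_anti _ _ (show r ≤ r + 1 by omega)
  have b6 := a1.rowLen_eq
  omega

/-- A deleted box moves at most one column to the right when an odd letter is taken into
account. -/
theorem del_col_le (h : Trace T x p S e) (hT : IsTableau T) {l r r' c c' : ℕ}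
    (hl : 2 * m ≤ l) (h1 : e l = .del r c) (h2 : e (l + 1) = .del r' c') (hr : r ≤ r') :
    c' ≤ c + 1 := by
  by_contra! h0
  have a1 := h.rel_del h1
  have a2 := h.rel_del h2
  have b1 := a2.colLen_self
  have b2 := (level T (l + 1)).colLen_anti _ _ (show c + 1 + 1 ≤ c' by omega)
  have b3 := hT.colLen_level_succ_le hl (c + 1)
  have b4 := a1.colLen_of_ne (show c + 1 ≠ c by omega)
  have b5 := (level S l).colLen_anti _ _ (show c ≤ c + 1 by omega)
  have b6 := a1.colLen_eq
  omega

end Trace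

/-! ### Two successive insertions -/

/-- The possible effects of two successive insertions of letters `x ≤ y` in `B₀` on the shape
formed by some letters in `B₀`. -/
inductive EvenPair : Edge → Edge → Prop
  | none (e : Edge) : EvenPair e .none
  | canc_canc : EvenPair .canc .canc
  | canc_add {r c : ℕ} : EvenPair .canc (.add r c)
  | add_add {r c r' c' : ℕ} (h : r' ≤ r) : EvenPair (.add r c) (.add r' c')
  | del_canc {r c : ℕ} : EvenPair (.del r c) .canc
  | del_add {r c r' c' : ℕ} : EvenPair (.del r c) (.add r' c')
  | del_del {r c r' c' : ℕ} (h : r ≤ r') : EvenPair (.del r c) (.del r' c')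

/-- The possible effects of two successive insertions of letters of a row on the shape formed by
all letters of `B₀` and some letters of `B₁`. -/
inductive OddPair : Edge → Edge → Prop
  | none (e : Edge) : OddPair .none e
  | add_add {r c r' c' : ℕ} (h : c < c') : OddPair (.add r c) (.add r' c')
  | add_del {r c r' c' : ℕ} (h : ¬ (r = 0 ∧ r' = 0)) : OddPair (.add r c) (.del r' c')
  | del_add {r c r' c' : ℕ} : OddPair (.del r c) (.add r' c')
  | del_del {r c r' c' : ℕ} (h : c' < c) : OddPair (.del r c) (.del r' c')

section Pair

variable {T T' T'' : Filling m n} {x y : Letter m n} {e e' : ℕ → Edge}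

/-- If the first insertion puts the `i`-th unbarred letter into its own row, it either displaces a
barred partner, which the symplectic condition forbids in the next row, or leaves the row without
any such partner. In the latter case the second insertion finds nothing to cancel. -/
theorem not_add_canc (hT' : IsTableau T') (hT'' : IsTableau T'')
    (h : Trace T x 0 T' e) (h' : Trace T' y 0 T'' e') {i c : ℕ}
    (hi : 2 * i + 1 < 2 * m) (h1 : e (2 * i + 1) = .add i c) : e' (2 * i + 1) ≠ .canc := by
  intro h2
  have s1 := h.step_of_eq h1 (by simp)
  have s2 := h'.step_of_eq h2 (by simp)
  have a1 := h.rel_add h1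
  have a2 := h'.rel_canc h2
  generalize hE' : e' (2 * i + 1 + 1) = E' at s2
  generalize hE : e (2 * i + 1 + 1) = E at s1
  cases s2 with
  | @rem r c' _ hl =>
    obtain rfl : i = r := by omega
    have a3 := h'.rel_del hE'
    cases s1 with
    | stay =>
      have a4 := h.rel_add hE
      have b1 := a1.rowLen_self
      have b2 := a4.rowLen_self
      have b3 := a3.rowLen_self
      have b4 := a3.rowLen_eq
      have b5 := hT''.rowLen_level_le (2 * i + 1) i
      rw [a2] at b5
      omega
    | even _ =>
      have a4 := h.rel_add hE
      have := hT'.lt_of_mem_level (by omega) a4.mem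
      omega
    | odd _ => omega
    | canc _ hl => omega

/-- This is the row bumping lemma, carried out one letter at a time: the second path stays weakly
above the first while both add boxes, and weakly below while both delete. The decisive exclusions
are a cancellation or deletion after an addition. -/
theorem evenPair (hT : IsTableau T) (hT' : IsTableau T') (hT'' : IsTableau T'')
    (h : Trace T x 0 T' e) (h' : Trace T' y 0 T'' e') (hxy : x ≤ y)
    (l : ℕ) (hl : l ≤ 2 * m) : EvenPair (e l) (e' l) := by
  rw [Letter.le_iff_key] at hxy
  induction l with
  | zero =>
    rw [h'.before 0 (by omega)]
    exact .none _
  | succ l ih =>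
    replace ih := ih (by omega)
    rcases lt_trichotomy l y.key with hly | hly | hly
    · rw [h'.before (l + 1) (by omega)]
      exact .none _
    · rcases h'.start with ⟨-, c', h2⟩ | ⟨h1, -⟩ | ⟨h1, h2, h3⟩
      · rw [← hly] at h2
        rw [h2]
        have hne := h.ne_none (show x.key < l + 1 by omega)
        generalize e (l + 1) = E at hne
        cases E with
        | none => exact absurd rfl hne
        | canc => exact .canc_add
        | add r c => exact .add_add (Nat.zero_le _)
        | del r c => exact .del_add
      · omega
      -- An immediate cancellation takes place in row `0`, so `y`, and with it `x`, is the smallest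
      -- letter.
      · rw [← hly] at h3
        rw [h3]
        rcases h.start with ⟨-, c, h4⟩ | ⟨h4, -⟩ | ⟨-, h4, h5⟩
        · have hx0 : x.key = l := by omega
          have hl0 : l = 2 * 0 := by omega
          rw [hx0, hl0] at h4
          rw [hl0] at h3
          exact absurd h3 (not_add_canc hT' hT'' h h' (by omega) h4)
        · omega
        · have hx0 : x.key = l := by omega
          rw [hx0] at h5
          rw [h5]
          exact .canc_canc
    · have s1 := h.step l (by omega)
      have s2 := h'.step l hly
      generalize hA : e l = A at ih s1
      generalize hA' : e' l = A' at ih s2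
      generalize hE : e (l + 1) = E at s1
      generalize hE' : e' (l + 1) = E' at s2
      have hl' : l < 2 * m := hl
      cases ih with
      | none => cases s2
      | canc_canc =>
        cases s1 with
        | rem _ h1 =>
          cases s2 with
          | rem _ h2 => exact .del_del (by omega)
      | canc_add =>
        cases s1 with
        | rem _ h1 =>
          cases s2 with
          | stay => exact .del_add
          | even _ => exact .del_add
          | odd _ => omega
          | canc _ h2 => omega
      | @add_add r c r' c' hr =>
        have a1 := h.rel_add hA
        have a1' := h'.rel_add hA'
        cases s1 with
        | stay =>
          have a2 := h.rel_add hE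
          cases s2 with
          | stay => exact .add_add hr
          | even _ =>
            -- In the same row, the first insertion has left no letter with key `l` there, so the
            -- second cannot displace one.
            rcases hr.eq_or_lt with rfl | hr
            · exfalso
              have a2' := h'.rel_add hE'
              have b1 := a1'.rowLen_self
              have b2 := a1'.rowLen_eq
              have b3 := a1.rowLen_self
              have b4 := a2.rowLen_self
              have b5 := a2'.rowLen_of_ne (show r' ≠ r' + 1 by omega)
              have b6 := hT''.rowLen_level_le l r'
              omega
            · exact .add_add hr
          | odd _ => omega
          | canc _ h2 =>
            exfalso
            have a2' := h'.rel_canc hE'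
            rcases hr.eq_or_lt with rfl | hr
            · have b1 := a1'.rowLen_self
              have b2 := a1'.rowLen_eq
              have b3 := a1.rowLen_self
              have b4 := a2.rowLen_self
              have b6 := hT''.rowLen_level_le l r'
              rw [a2'] at b6
              omega
            · have := hT'.lt_of_mem_level (by omega) a1.mem
              omega
        | even _ =>
          have a2 := h.rel_add hE
          cases s2 with
          | stay => exact .add_add (by omega)
          | even _ => exact .add_add (by omega)
          | odd _ => omega
          | canc _ h2 =>
            exfalso
            -- The symplectic condition bounds the row reached by the first path, so both paths
            -- arrive in the same row, the case excluded by `not_add_canc`.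
            have := hT'.lt_of_mem_level hl a2.mem
            obtain rfl : r = r' := by omega
            subst h2
            exact not_add_canc hT' hT'' h h' (by omega) hE hE'
        | odd _ => omega
        | canc _ h1 =>
          cases s2 with
          | stay => exact .canc_add
          | even _ => exact .canc_add
          | odd _ => omega
          | canc _ h2 => exact .canc_canc
      | del_canc =>
        cases s1 with
        | del hr hc =>
          cases s2 with
          | rem _ h2 =>
            have := hT.lt_of_mem_level hl (h.rel_del hE).mem
            exact .del_del (by omega)
      | del_add =>
        cases s1 with
        | del hr hc =>
          cases s2 with
          | stay => exact .del_add
          | even _ => exact .del_add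
          | odd _ => omega
          | canc _ h2 => exact .del_canc
      | @del_del r c r' c' hrr =>
        cases s1 with
        | @del _ r2 _ c2 hr hc =>
          cases s2 with
          | @del _ r2' _ c2' hr' hc' =>
            -- The order could only be lost if both deletions share row `r` at level `l` and the
            -- first alone drops to row `r + 1`. Then row `r + 1` of `T''` would be too long for the
            -- horizontal strip of letters with key `l`.
            refine .del_del ?_
            by_contra h0
            have b0 := h.del_row_le hT hl' hA hE hc
            obtain rfl : r = r' := by omega
            obtain rfl : r2' = r := by omega
            obtain rfl : r2 = r2' + 1 := by omega
            have a1 := h.rel_del hA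
            have a1' := h'.rel_del hA'
            have a2 := h.rel_del hE
            have a2' := h'.rel_del hE'
            have b1 := a1.rowLen_eq
            have b2 := a1'.rowLen_self
            have b3 := a1'.rowLen_eq
            have b4 := a2.rowLen_eq
            have b5 := a2'.rowLen_of_ne (show r2' + 1 ≠ r2' by omega)
            have b6 := hT''.rowLen_level_succ_le hl' r2'
            omega

/-- At level `2 * m` no cancellation is pending, and the weak row inequalities become strict column
inequalities, since the boxes lie at the ends of rows of the same diagram `level T' (2 * m)`. -/
theorem OddPair.of_evenPair (h : Trace T x 0 T' e) (h' : Trace T' y 0 T'' e')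
    (hy : y.key < 2 * m) (hp : EvenPair (e (2 * m)) (e' (2 * m))) :
    OddPair (e (2 * m)) (e' (2 * m)) := by
  have n1 := h.ne_canc le_rfl
  have n2 := h'.ne_canc le_rfl
  have n3 := h'.ne_none hy
  generalize hA : e (2 * m) = A at hp n1
  generalize hA' : e' (2 * m) = A' at hp n2 n3
  cases hp with
  | none => exact absurd rfl n3
  | canc_canc => exact absurd rfl n1
  | canc_add => exact absurd rfl n1
  | @add_add r c r' c' hr =>
    refine .add_add ?_
    have a1 := h.rel_add hA
    have a2 := h'.rel_add hA'
    have b1 := a1.rowLen_self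
    have b2 := a2.rowLen_eq
    have b3 := (level T' (2 * m)).rowLen_anti _ _ hr
    omega
  | del_canc => exact absurd rfl n2
  | del_add => exact .del_add
  | @del_del r c r' c' hr =>
    refine .del_del ?_
    have a1 := h.rel_del hA
    have a2 := h'.rel_del hA'
    have b1 := a1.rowLen_eq
    have b2 := a2.rowLen_self
    have b3 := (level T' (2 * m)).rowLen_anti _ _ hr
    omega

/-- Letters of `B₁` are bumped from column to column, so now columns are compared. The condition
`hxy` makes the first path the later one to start, in column `0`, by which time the second has
already begun. -/
theorem OddPair.succ (hT : IsTableau T) (hT' : IsTableau T')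
    (h : Trace T x 0 T' e) (h' : Trace T' y 0 T'' e') (hxy : 2 * m ≤ x.key → y < x)
    {l : ℕ} (hl : 2 * m ≤ l) (hp : OddPair (e l) (e' l)) :
    OddPair (e (l + 1)) (e' (l + 1)) := by
  rw [Letter.lt_iff_key] at hxy
  generalize hA : e l = A at hp
  generalize hA' : e' l = A' at hp
  generalize hE : e (l + 1) = E
  generalize hE' : e' (l + 1) = E'
  cases hp with
  | none =>
    rcases lt_trichotomy l x.key with hlx | hlx | hlx
    · rw [h.before (l + 1) (by omega)] at hE
      exact hE ▸ .none _
    · rcases h.start with ⟨h1, -⟩ | ⟨h1, r, h2⟩ | ⟨h1, -⟩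
      · omega
      · rw [← hlx, hE] at h2
        subst h2
        have a2 := h.rel_add hE
        have a1 := h.rel_none hA
        have s2 := h'.step l (by omega)
        rw [hA', hE'] at s2
        have b1 := a2.colLen_eq
        have b2 := a2.colLen_self
        have b3 := hT.colLen_level_le l 0
        cases s2 with
        | @stay r' c' =>
          refine .add_add (Nat.pos_of_ne_zero ?_)
          rintro rfl
          have b4 := (h'.rel_add hA').colLen_eq
          have b5 := (h'.rel_add hE').colLen_eq
          rw [a1] at b4
          omega
        | even _ => omega
        | odd _ => exact .add_add (Nat.succ_pos _)
        | @del r' r2' c' c2' hr hc =>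
          refine .add_del ?_
          rintro ⟨rfl, rfl⟩
          have b4 := (h'.rel_del hA').colLen_self
          have b5 := (level T' l).colLen_anti _ _ (Nat.zero_le c')
          rw [a1] at b4 b5
          omega
        | canc _ _ => omega
        | rem _ _ => omega
      · omega
    · exact absurd hA (h.ne_none hlx)
  | @add_add r c r' c' hcc =>
    have s1 := h.step_of_eq hA (by simp)
    have s2 := h'.step_of_eq hA' (by simp)
    have a1 := h.rel_add hA
    have a1' := h'.rel_add hA'
    rw [hE] at s1
    rw [hE'] at s2
    cases s1 with
    | stay =>
      cases s2 with
      | stay => exact .add_add hcc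
      | even _ => omega
      | odd _ => exact .add_add (by omega)
      | canc _ _ => omega
    | even _ => omega
    | @odd _ r2 _ _ =>
      have a2 := h.rel_add hE
      cases s2 with
      | stay =>
        -- The first insertion has just put a letter with key `l` into column `c + 1`; a second path
        -- entering that column below this level would have to displace it.
        refine .add_add (lt_of_le_of_ne hcc ?_)
        rintro rfl
        have a2' := h'.rel_add hE'
        have b1 := a1'.colLen_eq
        have b2 := a2'.colLen_eq
        have b3 := a1.colLen_of_ne (show c + 1 ≠ c by omega)
        have b4 := a2.colLen_self
        have b5 := a2.colLen_eq
        have b6 := hT.colLen_level_le l (c + 1)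
        omega
      | even _ => omega
      | odd _ => exact .add_add (by omega)
      | canc _ _ => omega
    | canc _ _ => omega
  | @add_del r c r' c' hrr =>
    have s1 := h.step_of_eq hA (by simp)
    have s2 := h'.step_of_eq hA' (by simp)
    have a1 := h.rel_add hA
    have a1' := h'.rel_del hA'
    rw [hE] at s1
    rw [hE'] at s2
    cases s2 with
    | @del _ r2' _ c2' hr' hc' =>
      have a2' := h'.rel_del hE'
      cases s1 with
      | stay => exact .add_del (by omega)
      | even _ => omega
      | @odd _ r2 _ _ =>
        have a2 := h.rel_add hE
        -- If both boxes reached row `0`, the deletion would move between columns bounded by `c` and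
        -- `c + 1`. Column `c` at level `l` is excluded by `hrr`; column `c + 1` was still empty in
        -- `T`, even at level `l + 1`.
        refine .add_del ?_
        rintro ⟨rfl, rfl⟩
        obtain rfl : r' = 0 := by omega
        have b1 := a1.colLen_self
        have b2 := a1'.colLen_eq
        have b3 := a1'.colLen_self
        have b4 : c ≤ c' := by
          by_contra h0
          have c1 := (level T'' l).colLen_anti _ _ (show c' ≤ c by omega)
          have c2 := a1'.colLen_of_ne (show c ≠ c' by omega)
          omega
        have b5 : c ≠ c' := by
          rintro rfl
          omega
        have b6 : c2' ≤ c + 1 := by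
          by_contra h0
          have c1 := (level T (l + 1)).colLen_anti _ _ (show c + 1 ≤ c2' by omega)
          have c2 := a2.colLen_of_ne (show c2' ≠ c + 1 by omega)
          have c3 := a2.colLen_eq
          have c4 := a2'.colLen_self
          omega
        obtain rfl : c' = c + 1 := by omega
        have b7 := a1.colLen_of_ne (show c + 1 ≠ c by omega)
        have b8 := hT.colLen_level_le l (c + 1)
        have b9 := a2.colLen_eq
        omega
      | canc _ _ => omega
  | del_add =>
    have s1 := h.step_of_eq hA (by simp)
    have s2 := h'.step_of_eq hA' (by simp)
    rw [hE] at s1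
    rw [hE'] at s2
    cases s1 with
    | del _ _ =>
      cases s2 with
      | stay => exact .del_add
      | even _ => omega
      | odd _ => exact .del_add
      | canc _ _ => omega
  | @del_del r c r' c' hcc =>
    have s1 := h.step_of_eq hA (by simp)
    have s2 := h'.step_of_eq hA' (by simp)
    rw [hE] at s1
    rw [hE'] at s2
    cases s1 with
    | @del _ r2 _ c2 hr hc =>
      cases s2 with
      | @del _ r2' _ c2' hr' hc' =>
        refine .del_del ?_
        by_contra h0
        have b0 := h'.del_col_le hT' hl hA' hE' hr'
        obtain rfl : c = c' + 1 := by omega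
        obtain rfl : c2' = c' + 1 := by omega
        obtain rfl : c2 = c' + 1 := by omega
        have a1 := h.rel_del hA
        have a1' := h'.rel_del hA'
        have a2 := h.rel_del hE
        have a2' := h'.rel_del hE'
        have b1 := a1.colLen_of_ne (show c' ≠ c' + 1 by omega)
        have b2 := a1'.colLen_self
        have b3 := a2.colLen_eq
        have b4 := a2.colLen_self
        have b5 := a2'.colLen_self
        have b6 := hT.colLen_level_succ_le hl c'
        omega

end Pair

/-! ### Additions separated by deletions -/

/-- `F 0, …, F k` arise by successive insertions of the letters `x 0, …, x (k - 1)`. -/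
structure Run (k : ℕ) (F : ℕ → Filling m n) (x : ℕ → Letter m n) (e : ℕ → ℕ → Edge) : Prop where
  tableau : ∀ s ≤ k, IsTableau (F s)
  trace : ∀ s < k, Trace (F s) (x s) 0 (F (s + 1)) (e s)

namespace Run

variable {k : ℕ} {F : ℕ → Filling m n} {x : ℕ → Letter m n} {e : ℕ → ℕ → Edge}

/-- After `t0`, column `c` contains a letter with key `l`, which would stop `t1` from adding the
same box at both levels. A deletion in between may remove this letter, but only by making columns `c
- 1` and `c` equally long at level `l`. Later deletions lie further left at that level and keep them
so, and then column `c` cannot grow at all. -/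
theorem not_add_add (h : Run k F x e) {t0 t1 l : ℕ} (h01 : t0 < t1) (h1 : t1 < k)
    (hl : 2 * m ≤ l) (hdel : ∀ s, t0 < s → s < t1 → ∀ l ≥ 2 * m, ∃ r c, e s l = .del r c)
    (hpair : ∀ s, t0 < s → s + 1 < t1 → ∀ l ≥ 2 * m, OddPair (e s l) (e (s + 1) l))
    {r r' r'' c : ℕ} (he0 : e t0 (l + 1) = .add r c)
    (hc : (level (F (t0 + 1)) l).colLen c = (level (F t0) l).colLen c)
    (he1 : e t1 l = .add r' c) : e t1 (l + 1) ≠ .add r'' c := by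
  intro he1'
  have claim : ∀ s, t0 + 1 ≤ s → s ≤ t1 →
      (level (F s) l).colLen c < (level (F s) (l + 1)).colLen c ∨
      ∃ y s', c = y + 1 ∧ s = s' + 1 ∧ t0 < s' ∧
        (level (F s) l).colLen y = (level (F s) l).colLen c ∧
        ∃ r d, e s' l = .del r d ∧ d ≤ y := by
    intro s hs
    induction s, hs using Nat.le_induction with
    | base =>
      intro _
      have b1 := ((h.trace t0 (by omega)).rel_add he0).colLen_add c
      have b2 := (h.tableau t0 (by omega)).colLen_level_le l c
      rw [if_pos rfl] at b1
      exact Or.inl (by omega)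
    | succ s hs ih =>
      intro hs1
      obtain ⟨a, d, had⟩ := hdel s (by omega) (by omega) l hl
      obtain ⟨A, D, hAD⟩ := hdel s (by omega) (by omega) (l + 1) (by omega)
      have tr := h.trace s (by omega)
      have st := tr.step_of_eq had (by simp)
      rw [hAD] at st
      obtain ⟨haA, hdD⟩ : a ≤ A ∧ d ≤ D := by
        cases st with
        | del h1 h2 => exact ⟨h1, h2⟩
      have hD := tr.del_col_le (h.tableau s (by omega)) hl had hAD haA
      have a1 := tr.rel_del had
      have a2 := tr.rel_del hAD
      rcases ih (by omega) with h2 | ⟨y, s', rfl, rfl, h3, h4, a', d', h5, h6⟩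
      · by_cases hDc : D = c
        · subst hDc
          have b2 := a2.colLen_add D
          have b1 := a1.colLen_add D
          rw [if_pos rfl] at b2
          by_cases hd : d = D
          · rw [if_pos hd.symm] at b1
            exact Or.inl (by omega)
          · obtain rfl : D = d + 1 := by omega
            have b3 := a2.colLen_eq
            have b4 := a1.colLen_eq
            have b5 := (level (F (s + 1)) l).colLen_anti _ _ (show d ≤ d + 1 by omega)
            by_cases h7 : (level (F (s + 1)) l).colLen (d + 1) <
                (level (F (s + 1)) (l + 1)).colLen (d + 1)
            · exact Or.inl h7
            · exact Or.inr ⟨d, s, rfl, rfl, by omega, by omega, a, d, had, le_rfl⟩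
        · have b2 := a2.colLen_of_ne (Ne.symm hDc)
          have b1 := a1.colLen_add c
          exact Or.inl (by omega)
      · right
        have hp := hpair s' h3 (by omega) l hl
        rw [h5, had] at hp
        have hdd : d < d' := by
          cases hp with
          | del_del h => exact h
        have b1 := a1.colLen_of_ne (show y ≠ d by omega)
        have b2 := a1.colLen_of_ne (show y + 1 ≠ d by omega)
        exact ⟨y, s' + 1, rfl, rfl, by omega, by omega, a, d, had, by omega⟩
  have tr := h.trace t1 h1
  have a1 := tr.rel_add he1
  have st := tr.step_of_eq he1 (by simp)
  rw [he1'] at st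
  have hr : r'' = r' := by
    cases st with
    | stay => rfl
    | even _ => omega
  have a2 := tr.rel_add he1'
  have b1 := a1.colLen_eq
  have b2 := a2.colLen_eq
  rcases claim t1 h01 le_rfl with h2 | ⟨y, s', rfl, -, -, h4, -⟩
  · omega
  · have b3 := a1.colLen_of_ne (show y ≠ y + 1 by omega)
    have b4 := a1.colLen_self
    have b5 := (level (F (t1 + 1)) l).colLen_anti _ _ (show y ≤ y + 1 by omega)
    omega

/-- Induction on the level. The path of `t0` starts in column `0` or moves one column right; in
either case it leaves a new letter in that column, and by `not_add_add` the path of `t1` cannot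
remain there. -/
theorem col_lt (h : Run k F x e) {t0 t1 : ℕ} (h01 : t0 < t1) (h1 : t1 < k)
    (hx0 : 2 * m ≤ (x t0).key) (hx1 : (x t1).key < 2 * m)
    (hdel : ∀ s, t0 < s → s < t1 → ∀ l ≥ 2 * m, ∃ r c, e s l = .del r c)
    (hpair : ∀ s, t0 < s → s + 1 < t1 → ∀ l ≥ 2 * m, OddPair (e s l) (e (s + 1) l))
    {l : ℕ} (hl : 2 * m ≤ l) : ∀ {r c r' c' : ℕ}, e t0 l = .add r c → e t1 l = .add r' c' →
      c < c' := by
  induction l, hl using Nat.le_induction with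
  | base =>
    intro r c r' c' he0
    rw [(h.trace t0 (by omega)).before _ hx0] at he0
    cases he0
  | succ l hl ih =>
    intro r c r' c' he0 he1
    have tr0 := h.trace t0 (by omega)
    have tr1 := h.trace t1 h1
    have st1 := tr1.step l (by omega)
    rw [he1] at st1
    have key := fun r0 hc he => h.not_add_add h01 h1 hl hdel hpair (r' := r0) (r'' := r') he0 hc he
    rcases lt_trichotomy l (x t0).key with hlx | hlx | hlx
    · rw [tr0.before _ (by omega)] at he0
      cases he0
    · have hc : c = 0 := by
        rcases tr0.start with ⟨h2, -⟩ | ⟨-, r0, h2⟩ | ⟨h2, -⟩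
        · omega
        · rw [← hlx, he0] at h2
          cases h2
          rfl
        · omega
      subst hc
      have a1 := tr0.rel_none (tr0.before l hlx.le)
      by_contra h0
      obtain rfl : c' = 0 := by omega
      generalize hA : e t1 l = A at st1
      cases st1 with
      | stay => exact key r' (by rw [a1]) hA he1
      | even _ => omega
    · have st0 := tr0.step l hlx
      rw [he0] at st0
      generalize hA : e t1 l = A at st1
      generalize hB : e t0 l = B at st0
      cases st0 with
      | stay =>
        cases st1 with
        | stay => exact ih hB hA
        | even _ => omega
        | odd _ =>
          have := ih hB hA
          omega
      | even _ => omega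
      | @odd r0 _ c0 _ =>
        cases st1 with
        | stay =>
          have hlt := ih hB hA
          by_contra h0
          obtain rfl : c' = c0 + 1 := by omega
          exact key r' ((tr0.rel_add hB).colLen_of_ne (by omega)) hA he1
        | even _ => omega
        | odd _ =>
          have := ih hB hA
          omega

end Run

/-- Every word can be inserted into a tableau. -/
theorem exists_run (z : Letter m n) : ∀ (w : List (Letter m n)) {T : Filling m n}, IsTableau T →
    ∃ F e, F 0 = T ∧ InsertWord T w (F w.length) ∧
      Run w.length F (fun s => w.getD s z) e := by
  intro w
  induction w with
  | nil =>
    intro T hT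
    exact ⟨fun _ => T, fun _ _ => .none, rfl, .nil, fun _ _ => hT, fun s hs => by simp at hs⟩
  | cons a w ih =>
    intro T hT
    obtain ⟨R, e1, h1, hR, h2⟩ := exists_insert (2 * m + n) hT (canEnter_zero hT a) (by omega)
    obtain ⟨F, e, rfl, h3, h4⟩ := ih hR
    refine ⟨fun s => Nat.casesOn s T F, fun s => Nat.casesOn s e1 e, rfl, .cons h1 h3, ?_, ?_⟩
    · rintro (_ | s) hs
      · exact hT
      · exact h4.tableau s (by simpa using hs)
    · rintro (_ | s) hs
      · exact h2
      · exact h4.trace s (by simpa using hs)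

/-! ### Horizontal strips and the exchange of adding and removing -/

theorem mem_skew {lam mu : YoungDiagram} {c : ℕ × ℕ} : c ∈ skew lam mu ↔ c ∈ lam ∧ c ∉ mu := by
  simp [skew]

theorem card_skew_add {lam mu : YoungDiagram} (h : mu ≤ lam) :
    (skew lam mu).card + mu.card = lam.card :=
  Finset.card_sdiff_add_card_eq_card (YoungDiagram.cells_subset_iff.2 h)

theorem mem_skew_of_rowLen_lt {lam mu : YoungDiagram} {i : ℕ} (h : mu.rowLen i < lam.rowLen i) :
    (i, lam.rowLen i - 1) ∈ skew lam mu := by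
  rw [mem_skew, YoungDiagram.mem_iff_lt_rowLen, YoungDiagram.mem_iff_lt_rowLen]
  omega

theorem isHorizontalStrip_iff {lam mu : YoungDiagram} : IsHorizontalStrip lam mu ↔
    ∀ i, mu.rowLen i ≤ lam.rowLen i ∧ lam.rowLen (i + 1) ≤ mu.rowLen i := by
  constructor
  · rintro ⟨hle, hcol⟩ i
    constructor
    · by_contra! h
      exact lt_irrefl _ (YoungDiagram.mem_iff_lt_rowLen.1
        (hle (YoungDiagram.mem_iff_lt_rowLen.2 h)))
    · by_contra! h
      have h1 := lam.rowLen_anti _ _ (show i ≤ i + 1 by omega)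
      have h2 := mu.rowLen_anti _ _ (show i ≤ i + 1 by omega)
      have := hcol (i, mu.rowLen i)
        (by rw [mem_skew, YoungDiagram.mem_iff_lt_rowLen, YoungDiagram.mem_iff_lt_rowLen]; omega)
        (i + 1, mu.rowLen i)
        (by rw [mem_skew, YoungDiagram.mem_iff_lt_rowLen, YoungDiagram.mem_iff_lt_rowLen]; omega)
        rfl
      simp at this
  · intro h
    refine ⟨?_, ?_⟩
    · rintro ⟨i, j⟩ hm
      rw [YoungDiagram.mem_iff_lt_rowLen] at hm ⊢
      exact hm.trans_le (h i).1
    · have key : ∀ i i' j, i < i' → (i, j) ∈ skew lam mu → (i', j) ∈ skew lam mu → False := by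
        intro i i' j hi h1 h2
        rw [mem_skew, YoungDiagram.mem_iff_lt_rowLen, YoungDiagram.mem_iff_lt_rowLen] at h1 h2
        have h3 := lam.rowLen_anti _ _ (show i + 1 ≤ i' by omega)
        have h4 := (h i).2
        omega
      rintro ⟨i, j⟩ hp ⟨i', j'⟩ hq hj
      obtain rfl : j = j' := hj
      rcases lt_trichotomy i i' with hi | rfl | hi
      · exact (key _ _ _ hi hp hq).elim
      · rfl
      · exact (key _ _ _ hi hq hp).elim

theorem card_eq_sum_rowLen (lam : YoungDiagram) {N : ℕ} (hN : lam.colLen 0 ≤ N) :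
    lam.card = ∑ i ∈ Finset.range N, lam.rowLen i := by
  unfold YoungDiagram.card
  rw [Finset.card_eq_sum_card_fiberwise (f := Prod.fst) (t := Finset.range N)]
  · refine Finset.sum_congr rfl fun i _ => ?_
    rw [YoungDiagram.rowLen_eq_card]
    rfl
  · rintro ⟨i, j⟩ hm
    rw [Finset.mem_coe, YoungDiagram.mem_cells] at hm
    have := YoungDiagram.mem_iff_lt_colLen.1 (lam.up_left_mem le_rfl (Nat.zero_le j) hm)
    simp only [Finset.coe_range, Set.mem_Iio]
    omega

theorem rowLen_eq_zero (lam : YoungDiagram) {N : ℕ} (hN : lam.colLen 0 ≤ N) :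
    lam.rowLen N = 0 := by
  by_contra h
  have := YoungDiagram.mem_iff_lt_colLen.1
    (YoungDiagram.mem_iff_lt_rowLen.2 (Nat.pos_of_ne_zero h))
  omega

theorem exists_diagram_of_rowLen (A : YoungDiagram) (f : ℕ → ℕ) (hf : ∀ i, f i ≤ A.rowLen i)
    (hanti : ∀ i, f (i + 1) ≤ f i) : ∃ mu : YoungDiagram, mu ≤ A ∧ ∀ i, mu.rowLen i = f i := by
  have hmem : ∀ i j, (i, j) ∈ A.cells.filter (fun p => p.2 < f p.1) ↔ j < f i := by
    intro i j
    rw [Finset.mem_filter, YoungDiagram.mem_cells, YoungDiagram.mem_iff_lt_rowLen]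
    have := hf i
    simp only [and_iff_right_iff_imp]
    omega
  have hlow : IsLowerSet (A.cells.filter (fun p => p.2 < f p.1) : Set (ℕ × ℕ)) := by
    rintro ⟨a, b⟩ ⟨c, d⟩ hle hm
    obtain ⟨hc, hd⟩ : c ≤ a ∧ d ≤ b := hle
    rw [Finset.mem_coe, hmem] at hm ⊢
    have := antitone_nat_of_succ_le hanti hc
    omega
  refine ⟨⟨_, hlow⟩, Finset.filter_subset _ _, fun i => ?_⟩
  have key : ∀ j, j < YoungDiagram.rowLen ⟨_, hlow⟩ i ↔ j < f i := fun j => by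
    rw [← YoungDiagram.mem_iff_lt_rowLen, ← YoungDiagram.mem_cells, hmem]
  exact le_antisymm (not_lt.1 fun h => lt_irrefl _ ((key _).1 h))
    (not_lt.1 fun h => lt_irrefl _ ((key _).2 h))

/-- Adding a horizontal strip and then removing one can be done in the other order, unless both
strips meet the first row; horizontal strips that are added to the right of the first one do not
interfere. -/
theorem exists_isSpBumpingSequence {A B C D : YoungDiagram} (hA : IsHorizontalStrip B A)
    (hC : IsHorizontalStrip B C) (hD : IsHorizontalStrip D C)
    (hcol : ∀ p ∈ skew D C, ∀ q ∈ skew B A, q.2 < p.2)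
    (hrow : ¬ ((∃ q ∈ skew B A, q.1 = 0) ∧ ∃ p ∈ skew B C, p.1 = 0)) :
    ∃ mu, IsSpBumpingSequence A mu D ∧ (skew A mu).card = (skew B C).card ∧
      (skew D mu).card = (skew B A).card + (skew D C).card := by
  have hA' := isHorizontalStrip_iff.1 hA
  have hC' := isHorizontalStrip_iff.1 hC
  have hD' := isHorizontalStrip_iff.1 hD
  -- The local rule for exchanging horizontal strips: from the common part of row `i` of `A` and
  -- `C`, as many boxes are removed as row `i + 1` of `B` has beyond both `A` and `C`.
  obtain ⟨mu, hmuA, hmu⟩ := exists_diagram_of_rowLen A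
    (fun i => min (A.rowLen i) (C.rowLen i) + max (A.rowLen (i + 1)) (C.rowLen (i + 1))
      - B.rowLen (i + 1))
    (fun i => by
      have := hA' (i + 1)
      have := hC' (i + 1)
      omega)
    (fun i => by
      have := hA' i
      have := hC' i
      have := hA' (i + 1)
      have := hC' (i + 1)
      have := hA' (i + 1 + 1)
      have := hC' (i + 1 + 1)
      omega)
  have hs1 : IsHorizontalStrip A mu := by
    refine isHorizontalStrip_iff.2 fun i => ?_
    rw [hmu]
    have := hA' i
    have := hC' i
    have := hA' (i + 1)
    have := hC' (i + 1)
    omega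
  have hs2 : IsHorizontalStrip D mu := by
    refine isHorizontalStrip_iff.2 fun i => ?_
    rw [hmu]
    have h1 := hA' i
    have h2 := hC' i
    have h3 := hA' (i + 1)
    have h4 := hC' (i + 1)
    have h5 := hD' i
    have h6 := hD' (i + 1)
    refine ⟨by omega, ?_⟩
    rcases h6.1.eq_or_lt with h7 | h7
    · omega
    -- If `D / C` has boxes in row `i + 1`, then all of `B / A` lies to their left. This forces rows
    -- `i` of `A` and `B` to agree and row `i + 1` of `B` to be the longer of those of `A` and `C`,
    -- so row `i` of `mu` is that of `C`.
    · have h8 : (i + 1, C.rowLen (i + 1)) ∈ skew D C := by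
        rw [mem_skew, YoungDiagram.mem_iff_lt_rowLen, YoungDiagram.mem_iff_lt_rowLen]
        omega
      have h9 : ∀ i', A.rowLen i' < B.rowLen i' → B.rowLen i' - 1 < C.rowLen (i + 1) :=
        fun i' h => hcol _ h8 _ (mem_skew_of_rowLen_lt h)
      have h10 := h9 i
      have h11 := h9 (i + 1)
      omega
  -- The rule never sees the excess in row `0`, so the sizes balance only if there is none; this is
  -- where `hrow` enters.
  have h0 : max (A.rowLen 0) (C.rowLen 0) = B.rowLen 0 := by
    have h1 := (hA' 0).1
    have h2 := (hC' 0).1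
    by_contra h3
    exact hrow ⟨⟨_, mem_skew_of_rowLen_lt (by omega), rfl⟩,
      ⟨_, mem_skew_of_rowLen_lt (by omega), rfl⟩⟩
  have hcard : mu.card + B.card = A.card + C.card := by
    obtain ⟨N, hNA, hNB, hNC, hNmu⟩ : ∃ N, A.colLen 0 ≤ N ∧ B.colLen 0 ≤ N ∧ C.colLen 0 ≤ N ∧
        mu.colLen 0 ≤ N := ⟨A.colLen 0 + B.colLen 0 + C.colLen 0 + mu.colLen 0, by omega⟩
    rw [card_eq_sum_rowLen A hNA, card_eq_sum_rowLen B hNB, card_eq_sum_rowLen C hNC,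
      card_eq_sum_rowLen mu hNmu]
    have e1 : ∀ f : ℕ → ℕ, f N = 0 →
        ∑ i ∈ Finset.range N, f (i + 1) + f 0 = ∑ i ∈ Finset.range N, f i := by
      intro f hf
      rw [← Finset.sum_range_succ', Finset.sum_range_succ, hf, add_zero]
    have e2 := e1 (fun i => max (A.rowLen i) (C.rowLen i))
      (by simp [rowLen_eq_zero A hNA, rowLen_eq_zero C hNC])
    have e3 := e1 B.rowLen (rowLen_eq_zero B hNB)
    have e4 : ∑ i ∈ Finset.range N, mu.rowLen i + ∑ i ∈ Finset.range N, B.rowLen (i + 1) =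
        ∑ i ∈ Finset.range N, min (A.rowLen i) (C.rowLen i) +
          ∑ i ∈ Finset.range N, max (A.rowLen (i + 1)) (C.rowLen (i + 1)) := by
      rw [← Finset.sum_add_distrib, ← Finset.sum_add_distrib]
      refine Finset.sum_congr rfl fun i _ => ?_
      rw [hmu]
      have := hA' i
      have := hC' i
      have := hA' (i + 1)
      have := hC' (i + 1)
      omega
    have e5 : ∑ i ∈ Finset.range N, min (A.rowLen i) (C.rowLen i) +
        ∑ i ∈ Finset.range N, max (A.rowLen i) (C.rowLen i) =
        ∑ i ∈ Finset.range N, A.rowLen i + ∑ i ∈ Finset.range N, C.rowLen i := by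
      rw [← Finset.sum_add_distrib, ← Finset.sum_add_distrib]
      exact Finset.sum_congr rfl fun i _ => min_add_max _ _
    beta_reduce at e2
    omega
  have c1 := card_skew_add hmuA
  have c2 := card_skew_add hs2.1
  have c3 := card_skew_add hA.1
  have c4 := card_skew_add hC.1
  have c5 := card_skew_add hD.1
  exact ⟨mu, ⟨hs1, hs2⟩, by omega, by omega⟩

/-! ### Chains of boxes moving right -/

/-- The diagrams `Y 0, …, Y N` arise by adding boxes, each one in a column to the right of the
previous one. -/
structure StripChain (N : ℕ) (Y : ℕ → YoungDiagram) (b : ℕ → ℕ × ℕ) : Prop where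
  adds : ∀ s < N, AddsBox (Y s) (Y (s + 1)) (b s)
  col : ∀ s, s + 1 < N → (b s).2 < (b (s + 1)).2

namespace StripChain

variable {N : ℕ} {Y : ℕ → YoungDiagram} {b : ℕ → ℕ × ℕ}

theorem col_lt (h : StripChain N Y b) {s s' : ℕ} (hs : s < s') : s' < N → (b s).2 < (b s').2 := by
  induction s', hs using Nat.le_induction with
  | base => exact h.col s
  | succ s' hs ih => exact fun h1 => (ih (by omega)).trans (h.col s' h1)

theorem mem_iff (h : StripChain N Y b) {M : ℕ} (hM : M ≤ N) (x : ℕ × ℕ) :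
    x ∈ Y M ↔ x ∈ Y 0 ∨ ∃ s < M, x = b s := by
  induction M with
  | zero => simp
  | succ M ih =>
    rw [(h.adds M hM).2, ih (by omega)]
    constructor
    · rintro ((h1 | ⟨s, h1, h2⟩) | h1)
      · exact Or.inl h1
      · exact Or.inr ⟨s, by omega, h2⟩
      · exact Or.inr ⟨M, by omega, h1⟩
    · rintro (h1 | ⟨s, h1, h2⟩)
      · exact Or.inl (Or.inl h1)
      · rcases (Nat.lt_succ_iff.1 h1).eq_or_lt with rfl | h3
        · exact Or.inr h2
        · exact Or.inl (Or.inr ⟨s, h3, h2⟩)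

theorem mem_skew_iff (h : StripChain N Y b) (x : ℕ × ℕ) :
    x ∈ skew (Y N) (Y 0) ↔ ∃ s < N, x = b s := by
  rw [mem_skew, h.mem_iff le_rfl]
  constructor
  · rintro ⟨h1 | h1, h2⟩
    · exact absurd h1 h2
    · exact h1
  · rintro ⟨s, h1, rfl⟩
    refine ⟨Or.inr ⟨s, h1, rfl⟩, fun h2 => (h.adds s h1).1 ?_⟩
    exact (h.mem_iff h1.le _).2 (Or.inl h2)

theorem isHorizontalStrip (h : StripChain N Y b) : IsHorizontalStrip (Y N) (Y 0) := by
  refine ⟨fun x hx => (h.mem_iff le_rfl x).2 (Or.inl hx), fun p hp q hq hpq => ?_⟩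
  obtain ⟨s, hs, rfl⟩ := (h.mem_skew_iff p).1 hp
  obtain ⟨s', hs', rfl⟩ := (h.mem_skew_iff q).1 hq
  rcases lt_trichotomy s s' with h1 | rfl | h1
  · exact absurd hpq (h.col_lt h1 hs').ne
  · rfl
  · exact absurd hpq.symm (h.col_lt h1 hs).ne

theorem card_skew (h : StripChain N Y b) : (skew (Y N) (Y 0)).card = N := by
  have : skew (Y N) (Y 0) = (Finset.range N).image b := by
    ext x
    rw [h.mem_skew_iff]
    simp only [Finset.mem_image, Finset.mem_range, eq_comm]
  rw [this, Finset.card_image_of_injOn, Finset.card_range]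
  intro s hs s' hs' hb
  rw [Finset.mem_coe, Finset.mem_range] at hs hs'
  rcases lt_trichotomy s s' with h1 | rfl | h1
  · exact absurd (congrArg Prod.snd hb) (h.col_lt h1 hs').ne
  · rfl
  · exact absurd (congrArg Prod.snd hb).symm (h.col_lt h1 hs).ne

/-- The last box is to the right of `q`, so the top of its column is also missing from `Y 0`; a
horizontal strip has only one box there. -/
theorem last_row_eq_zero (h : StripChain (N + 1) Y b) {q : ℕ × ℕ}
    (hq : q ∈ skew (Y (N + 1)) (Y 0)) (h0 : q.1 = 0) : (b N).1 = 0 := by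
  obtain ⟨s, hs, rfl⟩ := (h.mem_skew_iff q).1 hq
  rcases (Nat.lt_succ_iff.1 hs).eq_or_lt with rfl | hsN
  · exact h0
  · have h1 : b N ∈ skew (Y (N + 1)) (Y 0) := (h.mem_skew_iff _).2 ⟨N, by omega, rfl⟩
    have h2 : (0, (b N).2) ∈ skew (Y (N + 1)) (Y 0) := by
      refine mem_skew.2 ⟨(Y (N + 1)).up_left_mem (Nat.zero_le _) le_rfl (mem_skew.1 h1).1, ?_⟩
      intro h3
      have h4 := (Y 0).up_left_mem le_rfl (h.col_lt hsN (by omega)).le h3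
      have h5 : b s = (0, (b s).2) := Prod.ext h0 rfl
      exact (mem_skew.1 hq).2 (by rw [h5]; exact h4)
    exact congrArg Prod.fst (h.isHorizontalStrip.2 _ h1 _ h2 rfl)

end StripChain

/-! ### The insertion of a whole row -/

/-- The box that an edge adds or deletes. -/
def Edge.box : Edge → ℕ × ℕ
  | add r c => (r, c)
  | del r c => (r, c)
  | _ => (0, 0)

/-- The edge adds a box. -/
def Edge.IsAdd (e : Edge) : Prop := ∃ r c, e = .add r c

/-- The edge deletes a box. -/
def Edge.IsDel (e : Edge) : Prop := ∃ r c, e = .del r c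

namespace Trace

variable {T S : Filling m n} {x : Letter m n} {p : ℕ} {e : ℕ → Edge}

theorem isAdd_or_isDel (h : Trace T x p S e) {l : ℕ} (hx : x.key < l) (hl : 2 * m ≤ l) :
    (e l).IsAdd ∨ (e l).IsDel := by
  have h1 := h.ne_canc hl
  have h2 := h.ne_none hx
  generalize e l = E at h1 h2
  cases E with
  | none => exact absurd rfl h2
  | canc => exact absurd rfl h1
  | add r c => exact Or.inl ⟨r, c, rfl⟩
  | del r c => exact Or.inr ⟨r, c, rfl⟩

theorem isAdd_of_le (h : Trace T x p S e) {l l' : ℕ} (hl : 2 * m ≤ l) (hll : l ≤ l')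
    (ha : (e l).IsAdd) : (e l').IsAdd := by
  induction l', hll using Nat.le_induction with
  | base => exact ha
  | succ l' hll ih =>
    obtain ⟨r, c, he⟩ := ih
    have st := h.step_of_eq he (by simp)
    generalize e (l' + 1) = E at st
    cases st with
    | stay => exact ⟨_, _, rfl⟩
    | even _ => exact ⟨_, _, rfl⟩
    | odd _ => exact ⟨_, _, rfl⟩
    | canc _ _ => omega

theorem isDel_of_le (h : Trace T x p S e) {l l' : ℕ} (hll : l ≤ l')
    (ha : (e l).IsDel) : (e l').IsDel := by
  induction l', hll using Nat.le_induction with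
  | base => exact ha
  | succ l' hll ih =>
    obtain ⟨r, c, he⟩ := ih
    have st := h.step_of_eq he (by simp)
    generalize e (l' + 1) = E at st
    cases st with
    | del _ _ => exact ⟨_, _, rfl⟩

theorem isAdd_of_odd (h : Trace T x p S e) {l : ℕ} (hx : 2 * m ≤ x.key) (hl : x.key < l) :
    (e l).IsAdd := by
  refine h.isAdd_of_le (l := x.key + 1) (by omega) hl ?_
  rcases h.start with ⟨h1, -⟩ | ⟨-, r, h1⟩ | ⟨h1, -⟩
  · omega
  · exact ⟨_, _, h1⟩
  · omega

theorem addsBox_of_isAdd (h : Trace T x p S e) {l : ℕ} (ha : (e l).IsAdd) :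
    AddsBox (level T l) (level S l) (e l).box := by
  obtain ⟨r, c, he⟩ := ha
  rw [he]
  exact h.rel_add he

theorem addsBox_of_isDel (h : Trace T x p S e) {l : ℕ} (ha : (e l).IsDel) :
    AddsBox (level S l) (level T l) (e l).box := by
  obtain ⟨r, c, he⟩ := ha
  rw [he]
  exact h.rel_del he

end Trace

theorem OddPair.col_lt_of_isAdd {e e' : Edge} (h : OddPair e e') (he : e.IsAdd)
    (he' : e'.IsAdd) : e.box.2 < e'.box.2 := by
  obtain ⟨r, c, rfl⟩ := he
  obtain ⟨r', c', rfl⟩ := he'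
  cases h with
  | add_add h => exact h

theorem OddPair.col_lt_of_isDel {e e' : Edge} (h : OddPair e e') (he : e.IsDel)
    (he' : e'.IsDel) : e'.box.2 < e.box.2 := by
  obtain ⟨r, c, rfl⟩ := he
  obtain ⟨r', c', rfl⟩ := he'
  cases h with
  | del_del h => exact h

theorem OddPair.row_of_isAdd_of_isDel {e e' : Edge} (h : OddPair e e') (he : e.IsAdd)
    (he' : e'.IsDel) : ¬ (e.box.1 = 0 ∧ e'.box.1 = 0) := by
  obtain ⟨r, c, rfl⟩ := he
  obtain ⟨r', c', rfl⟩ := he'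
  cases h with
  | add_del h => exact h

/-- The first `t` letters are in `B₁` and decrease, the others are in `B₀` and increase weakly. -/
structure IsRowWord (k t : ℕ) (x : ℕ → Letter m n) : Prop where
  le : t ≤ k
  odd : ∀ s < t, 2 * m ≤ (x s).key
  even : ∀ s, t ≤ s → s < k → (x s).key < 2 * m
  lt : ∀ s, s + 1 < t → x (s + 1) < x s
  mono : ∀ s, t ≤ s → s + 1 < k → x s ≤ x (s + 1)

namespace Run

variable {k t : ℕ} {F : ℕ → Filling m n} {x : ℕ → Letter m n} {e : ℕ → ℕ → Edge}

theorem evenPair (h : Run k F x e) (hw : IsRowWord k t x) {s : ℕ} (hs : t ≤ s)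
    (hs' : s + 1 < k) : EvenPair (e s (2 * m)) (e (s + 1) (2 * m)) :=
  Spo.evenPair (h.tableau s (by omega)) (h.tableau (s + 1) (by omega))
    (h.tableau (s + 1 + 1) (by omega)) (h.trace s (by omega)) (h.trace (s + 1) hs')
    (hw.mono s hs hs') _ le_rfl

/-- At level `2 * m` a letter of `B₁` has had no effect yet, and two letters of `B₀` are covered by
`EvenPair`. The decrease needed afterwards also holds from the last letter of `B₁` to the first of
`B₀`. -/
theorem oddPair (h : Run k F x e) (hw : IsRowWord k t x) {s : ℕ} (hs : s + 1 < k) {l : ℕ}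
    (hl : 2 * m ≤ l) : OddPair (e s l) (e (s + 1) l) := by
  have tr := h.trace s (by omega)
  have tr' := h.trace (s + 1) hs
  induction l, hl using Nat.le_induction with
  | base =>
    rcases lt_or_ge s t with hst | hst
    · rw [tr.before _ (hw.odd s hst)]
      exact .none _
    · exact .of_evenPair tr tr' (hw.even _ (by omega) hs) (h.evenPair hw hst hs)
  | succ l hl ih =>
    refine ih.succ (h.tableau s (by omega)) (h.tableau (s + 1) (by omega)) tr tr' ?_ hl
    intro hx
    have hst : s < t := by
      by_contra h0
      have := hw.even s (by omega) (by omega)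
      omega
    rcases lt_or_ge (s + 1) t with hst' | hst'
    · exact hw.lt s hst'
    · have := hw.even _ hst' hs
      rw [Letter.lt_iff_key]
      omega

/-- From level `2 * m` on, a letter of `B₀` either adds at all levels or deletes at all levels.
`EvenPair` forbids a deletion after an addition, so `u` is the first index from `t` on that does not
delete. -/
theorem exists_split (h : Run k F x e) (hw : IsRowWord k t x) :
    ∃ u, t ≤ u ∧ u ≤ k ∧ (∀ s, t ≤ s → s < u → ∀ l ≥ 2 * m, (e s l).IsDel) ∧
      ∀ s, u ≤ s → s < k → ∀ l ≥ 2 * m, (e s l).IsAdd := by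
  classical
  have hex : ∃ u, t ≤ u ∧ (u < k → ¬ (e u (2 * m)).IsDel) := ⟨k, hw.le, by omega⟩
  have hmin := fun s (hs : s < Nat.find hex) => Nat.find_min hex hs
  obtain ⟨h1, h2⟩ := Nat.find_spec hex
  have h3 : Nat.find hex ≤ k := Nat.find_min' hex ⟨hw.le, by omega⟩
  generalize Nat.find hex = u at *
  refine ⟨u, h1, h3, ?_, ?_⟩
  · intro s hs hsu l hl
    refine (h.trace s (by omega)).isDel_of_le hl ?_
    by_contra h0
    exact hmin s hsu ⟨hs, fun _ => h0⟩
  · intro s hs hsk l hl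
    refine (h.trace s hsk).isAdd_of_le le_rfl hl ?_
    induction s, hs using Nat.le_induction with
    | base =>
      exact ((h.trace u hsk).isAdd_or_isDel (hw.even u h1 hsk) le_rfl).resolve_right (h2 hsk)
    | succ s hs ih =>
      obtain ⟨r, c, h4⟩ := ih (by omega)
      have h5 := h.evenPair hw (by omega) hsk
      refine ((h.trace _ hsk).isAdd_or_isDel (hw.even _ (by omega) hsk) le_rfl).resolve_right ?_
      rintro ⟨r', c', h6⟩
      rw [h4, h6] at h5
      cases h5

/-- The shapes before and after the insertion of a row form a bumping sequence. -/
theorem exists_isSpBumpingSequence (h : Run k F x e) (hw : IsRowWord k t x) :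
    ∃ (mu : YoungDiagram) (l : ℕ), l ≤ k ∧
      IsSpBumpingSequence (level (F 0) (2 * m + n)) mu (level (F k) (2 * m + n)) ∧
      (skew (level (F 0) (2 * m + n)) mu).card = l ∧
      (skew (level (F k) (2 * m + n)) mu).card = k - l := by
  obtain ⟨u, htu, huk, hdel, hadd⟩ := h.exists_split hw
  have htop : 2 * m ≤ 2 * m + n := by omega
  have hadd0 : ∀ s < t, (e s (2 * m + n)).IsAdd := fun s hs =>
    (h.trace s (by have := hw.le; omega)).isAdd_of_odd (hw.odd s hs) (x s).key_lt
  have c1 : StripChain t (fun s => level (F s) (2 * m + n))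
      (fun s => (e s (2 * m + n)).box) := by
    refine ⟨fun s hs => (h.trace s (by omega)).addsBox_of_isAdd (hadd0 s hs), fun s hs => ?_⟩
    exact (h.oddPair hw (by omega) htop).col_lt_of_isAdd (hadd0 s (by omega)) (hadd0 _ hs)
  -- The deletions are read backwards, which turns them into additions moving right.
  have c2 : StripChain (u - t) (fun s => level (F (u - s)) (2 * m + n))
      (fun s => (e (u - s - 1) (2 * m + n)).box) := by
    refine ⟨fun s hs => ?_, fun s hs => ?_⟩
    · have := (h.trace (u - s - 1) (by omega)).addsBox_of_isDel
        (hdel (u - s - 1) (by omega) (by omega) _ htop)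
      rwa [show u - s - 1 + 1 = u - s by omega] at this
    · have := (h.oddPair hw (s := u - (s + 1) - 1) (by omega) htop).col_lt_of_isDel
        (hdel _ (by omega) (by omega) _ htop) (hdel _ (by omega) (by omega) _ htop)
      rwa [show u - (s + 1) - 1 + 1 = u - s - 1 by omega] at this
  have c3 : StripChain (k - u) (fun s => level (F (u + s)) (2 * m + n))
      (fun s => (e (u + s) (2 * m + n)).box) := by
    refine ⟨fun s hs => (h.trace _ (by omega)).addsBox_of_isAdd
      (hadd _ (by omega) (by omega) _ htop), fun s hs => ?_⟩
    exact (h.oddPair hw (by omega) htop).col_lt_of_isAdd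
      (hadd _ (by omega) (by omega) _ htop) (hadd _ (by omega) (by omega) _ htop)
  have s1 := c1.isHorizontalStrip
  have s2 := c2.isHorizontalStrip
  have s3 := c3.isHorizontalStrip
  have n1 := c1.card_skew
  have n2 := c2.card_skew
  have n3 := c3.card_skew
  have m1 := c1.mem_skew_iff
  have m3 := c3.mem_skew_iff
  simp only [Nat.sub_zero, Nat.sub_sub_self htu, Nat.add_zero, Nat.add_sub_cancel' huk]
    at s2 s3 n2 n3 m3
  suffices hsuff : _ ∧ _ by
    obtain ⟨mu, h1, h2, h3⟩ := Spo.exists_isSpBumpingSequence s1 s2 s3 hsuff.1 hsuff.2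
    exact ⟨mu, u - t, by omega, h1, by omega, by omega⟩
  constructor
  · intro p hp q hq
    obtain ⟨s, hs, rfl⟩ := (m3 p).1 hp
    obtain ⟨s', hs', rfl⟩ := (m1 q).1 hq
    have key : (e (t - 1) (2 * m + n)).box.2 < (e (u + 0) (2 * m + n)).box.2 := by
      obtain ⟨r, c, he⟩ := hadd0 (t - 1) (by omega)
      obtain ⟨r', c', he'⟩ := hadd (u + 0) (by omega) (by omega) _ htop
      rw [he, he']
      exact h.col_lt (by omega) (by omega) (hw.odd _ (by omega)) (hw.even _ (by omega) (by omega))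
        (fun s hs hs' => hdel s (by omega) (by omega))
        (fun s hs hs' l hl => h.oddPair hw (by omega) hl) htop he he'
    have k1 : (e s' (2 * m + n)).box.2 ≤ (e (t - 1) (2 * m + n)).box.2 := by
      rcases (Nat.le_sub_one_of_lt hs').eq_or_lt with rfl | hs'
      · exact le_rfl
      · exact (c1.col_lt hs' (by omega)).le
    have k2 : (e (u + 0) (2 * m + n)).box.2 ≤ (e (u + s) (2 * m + n)).box.2 := by
      rcases (Nat.zero_le s).eq_or_lt with rfl | hs0
      · exact le_rfl
      · exact (c3.col_lt hs0 hs).le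
    exact (k1.trans_lt key).trans_le k2
  -- If both strips met the first row, so would the last box added and, the second chain being
  -- reversed, the first box deleted. These belong to adjacent insertions, for which `OddPair`
  -- excludes this.
  · rintro ⟨⟨q, hq, hq0⟩, p, hp, hp0⟩
    have ht : 0 < t := by
      obtain ⟨s, hs, -⟩ := (m1 q).1 hq
      omega
    obtain ⟨t', rfl⟩ : ∃ t', t = t' + 1 := ⟨t - 1, by omega⟩
    have htu' : t' + 1 < u := by
      rcases htu.eq_or_lt with htu | htu
      · rw [htu] at hp
        simp [mem_skew] at hp
      · exact htu
    have r1 := c1.last_row_eq_zero hq hq0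
    obtain ⟨v, hv⟩ : ∃ v, u - (t' + 1) = v + 1 := ⟨u - (t' + 1) - 1, by omega⟩
    rw [hv] at c2
    have r2 := c2.last_row_eq_zero (q := p)
      (by rwa [← hv, Nat.sub_sub_self htu, Nat.sub_zero]) hp0
    rw [show u - v - 1 = t' + 1 by omega] at r2
    exact (h.oddPair hw (by omega) htop).row_of_isAdd_of_isDel (hadd0 t' (by omega))
      (hdel _ le_rfl htu' _ htop) ⟨r1, r2⟩

end Run

/-- Filtering keeps the order of the row, and reversing the strictly increasing `B₁`-part makes it
decrease. The number `t` is the length of that part. -/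
theorem exists_isRowWord (z : Letter m n) {k : ℕ} {U : Filling m n}
    (hU : IsSpoTableau (oneRow k) U) :
    (productWord U k).length = k ∧
      ∃ t, IsRowWord k t fun s => (productWord U k).getD s z := by
  classical
  obtain ⟨hA, hs⟩ := isSpoTableau_iff.1 hU
  have hU' : ∀ j < k, ∃ a, U 0 j = some a := by
    intro j hj
    refine (hs 0 j).1 ?_
    rw [← YoungDiagram.mem_cells]
    simp [oneRow, hj]
  have hlen : ∀ j ≤ k, (rowWord U j).length = j := by
    intro j hj
    induction j with
    | zero => rfl
    | succ j ih =>
      obtain ⟨a, ha⟩ := hU' j hj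
      have := ih (by omega)
      unfold rowWord at this ⊢
      rw [List.range_succ, List.filterMap_append, List.length_append, this]
      simp [ha]
  have hpw : (rowWord U k).Pairwise RowLe := by
    unfold rowWord
    refine List.Pairwise.filterMap _ ?_ (List.pairwise_lt_range (n := k))
    intro i j hij a ha b hb
    exact hA.row hij ha hb
  set A := (rowWord U k).filter fun x => x.InB1 with hAdef
  set B := (rowWord U k).filter fun x => ¬ x.InB1 with hBdef
  have hpwA : A.Pairwise RowLe := hpw.filter _
  have hpwB : B.Pairwise RowLe := hpw.filter _
  have hmA : ∀ a ∈ A, 2 * m ≤ a.key := by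
    intro a ha
    rw [hAdef, List.mem_filter] at ha
    exact Letter.inB1_iff_key.1 (by simpa using ha.2)
  have hmB : ∀ a ∈ B, a.key < 2 * m := by
    intro a ha
    rw [hBdef, List.mem_filter] at ha
    have h1 : ¬ a.InB1 := by simpa using ha.2
    rw [Letter.inB1_iff_key] at h1
    omega
  have hAB : A.length + B.length = k := by
    rw [← hlen k le_rfl, hAdef, hBdef]
    have := List.length_eq_length_filter_add (l := rowWord U k) (fun x => decide x.InB1)
    rw [this]
    simp
  have hword : productWord U k = A.reverse ++ B := rfl
  have hlenW : (productWord U k).length = k := by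
    rw [hword, List.length_append, List.length_reverse, hAB]
  have gA : ∀ s (hs : s < A.length), (productWord U k).getD s z = A[A.length - 1 - s] := by
    intro s hs
    rw [hword, List.getD_append _ _ _ _ (by simpa using hs),
      List.getD_eq_getElem _ _ (by simpa using hs),
      List.getElem_reverse]
  have gB : ∀ s, A.length ≤ s → ∀ hs : s - A.length < B.length,
      (productWord U k).getD s z = B[s - A.length] := by
    intro s hs hs'
    rw [hword, List.getD_append_right _ _ _ _ (by simpa using hs), List.length_reverse,
      List.getD_eq_getElem _ _ hs']
  refine ⟨hlenW, A.length, by omega, ?_, ?_, ?_, ?_⟩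
  · intro s hs
    rw [gA s hs]
    exact hmA _ (List.getElem_mem _)
  · intro s hs hsk
    rw [gB s hs (by omega)]
    exact hmB _ (List.getElem_mem _)
  · intro s hs
    rw [gA s (by omega), gA (s + 1) hs, Letter.lt_iff_key]
    have h1 := rowLe_iff.1 (List.pairwise_iff_getElem.1 hpwA (A.length - 1 - (s + 1))
      (A.length - 1 - s) (by omega) (by omega) (by omega))
    have h2 := hmA _ (List.getElem_mem (show A.length - 1 - (s + 1) < A.length by omega))
    omega
  · intro s hs hsk
    rw [gB s hs (by omega), gB (s + 1) (by omega) (by omega), Letter.le_iff_key]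
    have h1 := rowLe_iff.1 (List.pairwise_iff_getElem.1 hpwB (s - A.length)
      (s + 1 - A.length) (by omega) (by omega) (by omega))
    omega

end Spo

theorem mainTheorem6 (m n : ℕ) (hm : 0 < m) (hn : 0 < n) (k : ℕ) (lam : YoungDiagram)
    (T U : Spo.Filling m n) (hT : Spo.IsSpoTableau lam T)
    (hU : Spo.IsSpoTableau (Spo.oneRow k) U) :
    ∃ (S : Spo.Filling m n) (nu : YoungDiagram),
      Spo.IsProduct T U k S ∧ Spo.IsSpoTableau nu S ∧
      ∃ (mu : YoungDiagram) (l : ℕ), l ≤ k ∧ Spo.IsSpBumpingSequence lam mu nu ∧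
        (Spo.skew lam mu).card = l ∧ (Spo.skew nu mu).card = k - l := by
  -- A default value for reading the word beyond its end, which does not affect the letters that are
  -- inserted.
  have z : Spo.Letter m n := .plain ⟨0, hm⟩
  obtain ⟨hlen, t, hw⟩ := Spo.exists_isRowWord z hU
  obtain ⟨F, e, h0, hins, hrun⟩ := Spo.exists_run z (Spo.productWord U k) ⟨lam, hT⟩
  rw [hlen] at hins hrun
  obtain ⟨nu, hnu⟩ := hrun.tableau k le_rfl
  have h1 := hrun.exists_isSpBumpingSequence hw
  rw [h0, Spo.IsTableau.level_top ⟨lam, hT⟩ hT, Spo.IsTableau.level_top ⟨nu, hnu⟩ hnu] at h1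
  exact ⟨F k, nu, hins, hnu, h1⟩
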